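/- Let $(\mathcal M,\circ,I,\bullet,J)$ be a duoidal (2-monoidal) category: $(\mathcal M,\circ,I)$ and $(\mathcal M,\bullet,J)$ are monoidal categories, equipped with morphisms $\delta:I\to I\bullet I$, $\varpi:J\circ J\to J$, $\tau:I\to J$ and a natural interchange law $\zeta:(X\bullet Y)\circ(Z\bullet W)\to(X\circ Z)\bullet(Y\circ W)$ such that $(J,\varpi,\tau)$ is a monoid in $(\mathcal M,\circ,I)$, $(I,\delta,\tau)$ is a comonoid in $(\mathcal M,\bullet,J)$, and the usual two associativity and four unitality axioms for $\zeta$ hold. For a monoid $D$ in $(\mathcal M,\circ,I)$ let $\mathcal M_D$ be its category of right modules; for a comonoid $D$ in $(\mathcal M,\bullet,J)$ let $\mathcal M^D$ be its category of right comodules. A bimonoid $A$ is a monoid $(A,\mu,\eta)$ in $(\mathcal M,\circ,I)$ and a comonoid $(A,\Delta,\varepsilon)$ in $(\mathcal M,\bullet,J)$ such that $\Delta\mu=(\mu\bullet\mu)\,\zeta\,(\Delta\circ\Delta)$, $\varepsilon\mu=\varpi(\varepsilon\circ\varepsilon)$, $\Delta\eta=(\eta\bullet\eta)\delta$ and $\varepsilon\eta=\tau$.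 A right $A$-comodule monoid is a monoid $B$ in $(\mathcal M,\circ,I)$ with a coassociative, counital coaction $\rho:B\to B\bullet A$ such that $\rho\mu=(\mu\bullet\mu)\zeta(\rho\circ\rho)$ and $\rho\eta=(\eta\bullet\eta)\delta$; the bimonoid $A$ is an $A$-comodule monoid via $\Delta$, and $I$ is itself a bimonoid. The category $\mathcal M^A_B$ of relative Hopf modules has as objects the right $B$-modules $(X,\gamma)$ with a coassociative, counital coaction $\rho:X\to X\bullet A$ such that $\rho\gamma=(\gamma\bullet\mu)\zeta(\rho\circ\rho)$, and as morphisms the morphisms of both $B$-modules and $A$-comodules. The objects of $\mathcal M^A_A$ are the $A$-Hopf modules. *Galois extensions.* For a comodule monoid $B$ and $X\in\mathcal M^A_B$, the coinvariant part of $X$ is the equalizer in $\mathcal M^I$ of the morphisms $\varphi^0=\rho\bullet I$ and $\varphi^1=((X\bullet\eta)\bullet I)\,\alpha^{-1}(X\bullet\delta)$ from $X\bullet I$ to $(X\bullet A)\bullet I$, where $\alpha$ is the associativity constraint. A morphism of monoids $\omega:D\to B$ is an $A$-Galois extension if 1. the coinvariant part of every $X\in\mathcal M^A_B$ exists; 2.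 $D$ is the coinvariant part of $B$, that is, $D$ is a monoid in $\mathcal M^I$, there is an equalizer $\iota:D\to B\bullet I$ of $\varphi^0,\varphi^1$ in $\mathcal M^I$ which is a morphism of monoids (for the multiplication $(\mu\bullet I)\,\zeta$, up to $I\circ I\cong I$, and the unit $(\eta\bullet I)\delta$ on $B\bullet I$), and $\omega$ is the composite $D\xrightarrow{\iota}B\bullet I\xrightarrow{B\bullet\tau}B\bullet J\cong B$; 3. for every right $D$-module $P$ the coequalizer $P\circ_D B$ of the two morphisms $(P\circ D)\circ B\rightrightarrows P\circ B$, induced by the action on $P$ and by the left $D$-action $\mu(\omega\circ B)$ on $B$, exists in $\mathcal M$ and is preserved by all powers of $(-)\circ B:\mathcal M\to\mathcal M$; 4. for every right $B$-module $(Q,\gamma)$ the morphism $\beta_Q:(Q\bullet I)\circ_D B\to Q\bullet A$, defined as the unique one whose composite with the projection $(Q\bullet I)\circ B\to(Q\bullet I)\circ_D B$ is $$(Q\bullet I)\circ B\xrightarrow{(Q\bullet I)\circ\rho}(Q\bullet I)\circ(B\bullet A)\xrightarrow{\zeta}(Q\circ B)\bullet(I\circ A)\cong(Q\circ B)\bullet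 A\xrightarrow{\gamma\bullet A}Q\bullet A,$$ is an isomorphism. Here $D$ acts on $Q$ through $\omega$, and $Q\bullet I$ is a $D$-module by $(Q\bullet I)\circ D\to(Q\bullet I)\circ(D\bullet I)\xrightarrow{\zeta}(Q\circ D)\bullet(I\circ I)\to Q\bullet I$. **Theorem.** Let $\mathcal M$ be a duoidal category in which idempotent morphisms split, and suppose that the functor $$H=\big(\mathcal M^I\xrightarrow{U^I}\mathcal M\xrightarrow{(-)\circ J}\mathcal M_J\big),$$ where $U^I$ is the forgetful functor and $(-)\circ J$ the free module functor, is fully faithful. Then for every bimonoid $A$ in $\mathcal M$ the following assertions are equivalent. (i) The unit $\eta:I\to A$ is an $A$-Galois extension (for the $A$-comodule monoid $A$ with coaction $\Delta$). (ii) The natural transformation $$\beta_Q=\big((Q\bullet I)\circ A\xrightarrow{(Q\bullet I)\circ\Delta}(Q\bullet I)\circ(A\bullet A)\xrightarrow{\zeta}(Q\circ A)\bullet(I\circ A)\cong(Q\circ A)\bullet A\xrightarrow{\gamma\bullet A}Q\bullet A\big),$$ for right $A$-modules $(Q,\gamma)$, is an isomorphism. (iii) The functor $K=(-)\circ A:\mathcal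 M^I\to\mathcal M^A_A$ is an equivalence of categories, where for an $I$-comodule $(Z,\rho)$ the action on $Z\circ A$ is that of the free $A$-module and the coaction is $$Z\circ A\xrightarrow{\rho\circ\Delta}(Z\bullet I)\circ(A\bullet A)\xrightarrow{\zeta}(Z\circ A)\bullet(I\circ A)\cong(Z\circ A)\bullet A.$$ -/

import Mathlib

universe v u

open CategoryTheory CategoryTheory.Limits

/-- A category with two monoidal structures: `circ` is the product `∘` with unit `I`, and
`bull` is the product `•` with unit `J`. -/
class DoubleMonoidal (C : Type u) [Category.{v} C] where
  circ : MonoidalCategory C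
  bull : MonoidalCategory C

namespace DoubleMonoidal

variable {C : Type u} [Category.{v} C] [DoubleMonoidal C]

/-- The product `X ∘ Y`. -/
abbrev circObj (X Y : C) : C := (circ (C := C)).tensorObj X Y

/-- The product `X • Y`. -/
abbrev bullObj (X Y : C) : C := (bull (C := C)).tensorObj X Y

/-- The product `f ∘ g` of morphisms. -/
abbrev circHom {X Y X' Y' : C} (f : X ⟶ Y) (g : X' ⟶ Y') : circObj X X' ⟶ circObj Y Y' :=
  (circ (C := C)).tensorHom f g

/-- The product `f • g` of morphisms. -/
abbrev bullHom {X Y X' Y' : C} (f : X ⟶ Y) (g : X' ⟶ Y') : bullObj X X' ⟶ bullObj Y Y' :=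
  (bull (C := C)).tensorHom f g

end DoubleMonoidal

infix:70 " ⊚ " => DoubleMonoidal.circObj
infix:70 " ⊚ₘ " => DoubleMonoidal.circHom
infix:70 " ● " => DoubleMonoidal.bullObj
infix:70 " ●ₘ " => DoubleMonoidal.bullHom

namespace DoubleMonoidal

section

variable (C : Type u) [Category.{v} C] [DoubleMonoidal C]

/-- The unit `I` of the product `∘`. -/
abbrev unitI : C := (circ (C := C)).tensorUnit

/-- The unit `J` of the product `•`. -/
abbrev unitJ : C := (bull (C := C)).tensorUnit

end

variable {C : Type u} [Category.{v} C] [DoubleMonoidal C]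

/-- Associativity constraint of `∘`. -/
abbrev aC (X Y Z : C) : (X ⊚ Y) ⊚ Z ≅ X ⊚ (Y ⊚ Z) := (circ (C := C)).associator X Y Z

/-- Left unit constraint of `∘`. -/
abbrev lC (X : C) : unitI C ⊚ X ≅ X := (circ (C := C)).leftUnitor X

/-- Right unit constraint of `∘`. -/
abbrev rC (X : C) : X ⊚ unitI C ≅ X := (circ (C := C)).rightUnitor X

/-- Associativity constraint of `•`. -/
abbrev aB (X Y Z : C) : (X ● Y) ● Z ≅ X ● (Y ● Z) := (bull (C := C)).associator X Y Z

/-- Left unit constraint of `•`. -/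
abbrev lB (X : C) : unitJ C ● X ≅ X := (bull (C := C)).leftUnitor X

/-- Right unit constraint of `•`. -/
abbrev rB (X : C) : X ● unitJ C ≅ X := (bull (C := C)).rightUnitor X

/-- Monoids in `(C, ∘, I)`. -/
abbrev CircMon (X : C) := @MonObj C _ circ X

/-- Comonoids in `(C, •, J)`. -/
abbrev BullComon (X : C) := @ComonObj C _ bull X

/-- Morphisms of monoids in `(C, ∘, I)`. -/
abbrev IsCircMonHom {X Y : C} [CircMon X] [CircMon Y] (f : X ⟶ Y) : Prop :=
  @IsMonHom C _ circ X Y _ _ f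

/-- Multiplication `μ : X ∘ X ⟶ X`. -/
abbrev mulC (X : C) [m : CircMon X] : X ⊚ X ⟶ X := @MonObj.mul C _ circ X m

/-- Unit `η : I ⟶ X`. -/
abbrev oneC (X : C) [m : CircMon X] : unitI C ⟶ X := @MonObj.one C _ circ X m

/-- Comultiplication `Δ : X ⟶ X • X`. -/
abbrev comulB (X : C) [m : BullComon X] : X ⟶ X ● X := @ComonObj.comul C _ bull X m

/-- Counit `ε : X ⟶ J`. -/
abbrev counitB (X : C) [m : BullComon X] : X ⟶ unitJ C := @ComonObj.counit C _ bull X m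

/-- The unit `I` is a monoid in `(C, ∘, I)` through the unit constraint. -/
instance circMonUnitI : CircMon (unitI C) := @MonObj.instTensorUnit C _ circ

section Lemmas

variable {X Y Z X' Y' Z' X'' Y'' : C}

theorem circ_comp (f : X ⟶ X') (g : Y ⟶ Y') (f' : X' ⟶ X'') (g' : Y' ⟶ Y'') :
    (f ⊚ₘ g) ≫ (f' ⊚ₘ g') = (f ≫ f') ⊚ₘ (g ≫ g') :=
  (circ (C := C)).tensorHom_comp_tensorHom f g f' g'

theorem bull_comp (f : X ⟶ X') (g : Y ⟶ Y') (f' : X' ⟶ X'') (g' : Y' ⟶ Y'') :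
    (f ●ₘ g) ≫ (f' ●ₘ g') = (f ≫ f') ●ₘ (g ≫ g') :=
  (bull (C := C)).tensorHom_comp_tensorHom f g f' g'

theorem circ_comp_assoc {W : C} (f : X ⟶ X') (g : Y ⟶ Y') (f' : X' ⟶ X'') (g' : Y' ⟶ Y'')
    (h : X'' ⊚ Y'' ⟶ W) :
    (f ⊚ₘ g) ≫ (f' ⊚ₘ g') ≫ h = ((f ≫ f') ⊚ₘ (g ≫ g')) ≫ h := by
  rw [← Category.assoc, circ_comp]

theorem bull_comp_assoc {W : C} (f : X ⟶ X') (g : Y ⟶ Y') (f' : X' ⟶ X'') (g' : Y' ⟶ Y'')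
    (h : X'' ● Y'' ⟶ W) :
    (f ●ₘ g) ≫ (f' ●ₘ g') ≫ h = ((f ≫ f') ●ₘ (g ≫ g')) ≫ h := by
  rw [← Category.assoc, bull_comp]

theorem circ_id (X Y : C) : 𝟙 X ⊚ₘ 𝟙 Y = 𝟙 (X ⊚ Y) := (circ (C := C)).id_tensorHom_id X Y

theorem bull_id (X Y : C) : 𝟙 X ●ₘ 𝟙 Y = 𝟙 (X ● Y) := (bull (C := C)).id_tensorHom_id X Y

theorem aC_nat (f : X ⟶ X') (g : Y ⟶ Y') (h : Z ⟶ Z') :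
    ((f ⊚ₘ g) ⊚ₘ h) ≫ (aC X' Y' Z').hom = (aC X Y Z).hom ≫ (f ⊚ₘ (g ⊚ₘ h)) :=
  (circ (C := C)).associator_naturality f g h

theorem aB_nat (f : X ⟶ X') (g : Y ⟶ Y') (h : Z ⟶ Z') :
    ((f ●ₘ g) ●ₘ h) ≫ (aB X' Y' Z').hom = (aB X Y Z).hom ≫ (f ●ₘ (g ●ₘ h)) :=
  (bull (C := C)).associator_naturality f g h

theorem aB_inv_nat (f : X ⟶ X') (g : Y ⟶ Y') (h : Z ⟶ Z') :
    (f ●ₘ (g ●ₘ h)) ≫ (aB X' Y' Z').inv = (aB X Y Z).inv ≫ ((f ●ₘ g) ●ₘ h) := by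
  rw [Iso.comp_inv_eq, Category.assoc, aB_nat, Iso.inv_hom_id_assoc]

theorem lC_nat (f : X ⟶ Y) : (𝟙 (unitI C) ⊚ₘ f) ≫ (lC Y).hom = (lC X).hom ≫ f := by
  have := (circ (C := C)).leftUnitor_naturality f
  rwa [← @MonoidalCategory.id_tensorHom C _ circ] at this

theorem rC_nat (f : X ⟶ Y) : (f ⊚ₘ 𝟙 (unitI C)) ≫ (rC Y).hom = (rC X).hom ≫ f := by
  have := (circ (C := C)).rightUnitor_naturality f
  rwa [← @MonoidalCategory.tensorHom_id C _ circ] at this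

theorem lB_nat (f : X ⟶ Y) : (𝟙 (unitJ C) ●ₘ f) ≫ (lB Y).hom = (lB X).hom ≫ f := by
  have := (bull (C := C)).leftUnitor_naturality f
  rwa [← @MonoidalCategory.id_tensorHom C _ bull] at this

theorem rB_nat (f : X ⟶ Y) : (f ●ₘ 𝟙 (unitJ C)) ≫ (rB Y).hom = (rB X).hom ≫ f := by
  have := (bull (C := C)).rightUnitor_naturality f
  rwa [← @MonoidalCategory.tensorHom_id C _ bull] at this

theorem rC_inv_nat (f : X ⟶ Y) : f ≫ (rC Y).inv = (rC X).inv ≫ (f ⊚ₘ 𝟙 (unitI C)) := by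
  rw [Iso.comp_inv_eq, Category.assoc, rC_nat, Iso.inv_hom_id_assoc]

theorem lC_tensor (X Y : C) :
    (aC (unitI C) X Y).hom ≫ (lC (X ⊚ Y)).hom = (lC X).hom ⊚ₘ 𝟙 Y := by
  have := @MonoidalCategory.leftUnitor_tensor_hom C _ circ X Y
  rw [← @MonoidalCategory.tensorHom_id C _ circ] at this
  rw [this]
  exact Iso.hom_inv_id_assoc _ _

theorem rC_tensor (X Y : C) :
    (aC X Y (unitI C)).hom ≫ (𝟙 X ⊚ₘ (rC Y).hom) = (rC (X ⊚ Y)).hom := by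
  have := @MonoidalCategory.rightUnitor_tensor_hom C _ circ X Y
  rw [← @MonoidalCategory.id_tensorHom C _ circ] at this
  exact this.symm

theorem rB_tensor (X Y : C) :
    (aB X Y (unitJ C)).hom ≫ (𝟙 X ●ₘ (rB Y).hom) = (rB (X ● Y)).hom := by
  have := @MonoidalCategory.rightUnitor_tensor_hom C _ bull X Y
  rw [← @MonoidalCategory.id_tensorHom C _ bull] at this
  exact this.symm

theorem triangleC (X Y : C) :
    (aC X (unitI C) Y).hom ≫ (𝟙 X ⊚ₘ (lC Y).hom) = (rC X).hom ⊚ₘ 𝟙 Y := by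
  have := (circ (C := C)).triangle X Y
  rwa [← @MonoidalCategory.id_tensorHom C _ circ, ← @MonoidalCategory.tensorHom_id C _ circ]
    at this

theorem triangleB (X Y : C) :
    (aB X (unitJ C) Y).hom ≫ (𝟙 X ●ₘ (lB Y).hom) = (rB X).hom ●ₘ 𝟙 Y := by
  have := (bull (C := C)).triangle X Y
  rwa [← @MonoidalCategory.id_tensorHom C _ bull, ← @MonoidalCategory.tensorHom_id C _ bull]
    at this

theorem pentagonC (W X Y Z : C) :
    ((aC W X Y).hom ⊚ₘ 𝟙 Z) ≫ (aC W (X ⊚ Y) Z).hom ≫ (𝟙 W ⊚ₘ (aC X Y Z).hom) =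
      (aC (W ⊚ X) Y Z).hom ≫ (aC W X (Y ⊚ Z)).hom := by
  have := (circ (C := C)).pentagon W X Y Z
  rwa [← @MonoidalCategory.id_tensorHom C _ circ, ← @MonoidalCategory.tensorHom_id C _ circ]
    at this

theorem pentagonB (W X Y Z : C) :
    ((aB W X Y).hom ●ₘ 𝟙 Z) ≫ (aB W (X ● Y) Z).hom ≫ (𝟙 W ●ₘ (aB X Y Z).hom) =
      (aB (W ● X) Y Z).hom ≫ (aB W X (Y ● Z)).hom := by
  have := (bull (C := C)).pentagon W X Y Z
  rwa [← @MonoidalCategory.id_tensorHom C _ bull, ← @MonoidalCategory.tensorHom_id C _ bull]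
    at this

theorem one_mulC (X : C) [CircMon X] : (oneC X ⊚ₘ 𝟙 X) ≫ mulC X = (lC X).hom := by
  have := @MonObj.one_mul C _ circ X _
  rwa [← @MonoidalCategory.tensorHom_id C _ circ] at this

theorem mul_oneC (X : C) [CircMon X] : (𝟙 X ⊚ₘ oneC X) ≫ mulC X = (rC X).hom := by
  have := @MonObj.mul_one C _ circ X _
  rwa [← @MonoidalCategory.id_tensorHom C _ circ] at this

theorem mul_assocC (X : C) [CircMon X] :
    (mulC X ⊚ₘ 𝟙 X) ≫ mulC X = (aC X X X).hom ≫ (𝟙 X ⊚ₘ mulC X) ≫ mulC X := by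
  have := @MonObj.mul_assoc C _ circ X _
  rwa [← @MonoidalCategory.id_tensorHom C _ circ, ← @MonoidalCategory.tensorHom_id C _ circ]
    at this

theorem counit_comulB (X : C) [BullComon X] :
    comulB X ≫ (counitB X ●ₘ 𝟙 X) ≫ (lB X).hom = 𝟙 X := by
  have := @ComonObj.counit_comul C _ bull X _
  rw [← @MonoidalCategory.tensorHom_id C _ bull] at this
  rw [← Category.assoc]
  exact (congrArg (fun t => t ≫ (lB X).hom) this).trans (Iso.inv_hom_id _)

theorem comul_counitB (X : C) [BullComon X] :
    comulB X ≫ (𝟙 X ●ₘ counitB X) ≫ (rB X).hom = 𝟙 X := by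
  have := @ComonObj.comul_counit C _ bull X _
  rw [← @MonoidalCategory.id_tensorHom C _ bull] at this
  rw [← Category.assoc]
  exact (congrArg (fun t => t ≫ (rB X).hom) this).trans (Iso.inv_hom_id _)

theorem comul_assocB (X : C) [BullComon X] :
    comulB X ≫ (𝟙 X ●ₘ comulB X) =
      comulB X ≫ (comulB X ●ₘ 𝟙 X) ≫ (aB X X X).hom := by
  have := @ComonObj.comul_assoc C _ bull X _
  rwa [← @MonoidalCategory.id_tensorHom C _ bull, ← @MonoidalCategory.tensorHom_id C _ bull]
    at this

theorem mulC_unitI : mulC (unitI C) = (lC (unitI C)).hom := rfl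

theorem oneC_unitI : oneC (unitI C) = 𝟙 (unitI C) := rfl

end Lemmas

end DoubleMonoidal

open DoubleMonoidal

/-- A duoidal category (also called 2-monoidal): two monoidal structures `(∘, I)` and `(•, J)`,
morphisms `δ : I ⟶ I • I`, `ϖ : J ∘ J ⟶ J`, `τ : I ⟶ J` and an interchange law `ζ`.
`monJ` holds `ϖ` (multiplication) and `τ` (unit), `comonI` holds `δ` (comultiplication)
and `τ` (counit). -/
class DuoidalCategory (C : Type u) [Category.{v} C] extends DoubleMonoidal C where
  monJ : @MonObj C _ circ (unitJ C)
  comonI : @ComonObj C _ bull (unitI C)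
  one_eq_counit : oneC (unitJ C) = counitB (unitI C)
  zeta : ∀ X Y Z W : C, (X ● Y) ⊚ (Z ● W) ⟶ (X ⊚ Z) ● (Y ⊚ W)
  zeta_natural : ∀ {X Y Z W X' Y' Z' W' : C} (f : X ⟶ X') (g : Y ⟶ Y') (h : Z ⟶ Z')
    (k : W ⟶ W'), ((f ●ₘ g) ⊚ₘ (h ●ₘ k)) ≫ zeta X' Y' Z' W' =
      zeta X Y Z W ≫ ((f ⊚ₘ h) ●ₘ (g ⊚ₘ k))
  zeta_assoc_circ : ∀ X Y Z W U V : C,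
    (zeta X Y Z W ⊚ₘ 𝟙 (U ● V)) ≫ zeta (X ⊚ Z) (Y ⊚ W) U V ≫
        ((aC X Z U).hom ●ₘ (aC Y W V).hom) =
      (aC (X ● Y) (Z ● W) (U ● V)).hom ≫ (𝟙 (X ● Y) ⊚ₘ zeta Z W U V) ≫
        zeta X Y (Z ⊚ U) (W ⊚ V)
  zeta_assoc_bull : ∀ X Y Z W U V : C,
    zeta (X ● Y) Z (W ● U) V ≫ (zeta X Y W U ●ₘ 𝟙 (Z ⊚ V)) ≫
        (aB (X ⊚ W) (Y ⊚ U) (Z ⊚ V)).hom =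
      ((aB X Y Z).hom ⊚ₘ (aB W U V).hom) ≫ zeta X (Y ● Z) W (U ● V) ≫
        (𝟙 (X ⊚ W) ●ₘ zeta Y Z U V)
  left_unit_circ : ∀ X Y : C,
    (comulB (unitI C) ⊚ₘ 𝟙 (X ● Y)) ≫ zeta (unitI C) (unitI C) X Y ≫
      ((lC X).hom ●ₘ (lC Y).hom) = (lC (X ● Y)).hom
  right_unit_circ : ∀ X Y : C,
    (𝟙 (X ● Y) ⊚ₘ comulB (unitI C)) ≫ zeta X Y (unitI C) (unitI C) ≫
      ((rC X).hom ●ₘ (rC Y).hom) = (rC (X ● Y)).hom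
  left_unit_bull : ∀ X Y : C,
    zeta (unitJ C) X (unitJ C) Y ≫ (mulC (unitJ C) ●ₘ 𝟙 (X ⊚ Y)) ≫ (lB (X ⊚ Y)).hom =
      (lB X).hom ⊚ₘ (lB Y).hom
  right_unit_bull : ∀ X Y : C,
    zeta X (unitJ C) Y (unitJ C) ≫ (𝟙 (X ⊚ Y) ●ₘ mulC (unitJ C)) ≫ (rB (X ⊚ Y)).hom =
      (rB X).hom ⊚ₘ (rB Y).hom

namespace DuoidalCategory

variable {C : Type u} [Category.{v} C] [DuoidalCategory C]

attribute [reducible] monJ comonI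

attribute [instance] monJ comonI

/-- The morphism `τ : I ⟶ J`. -/
abbrev tau (C : Type u) [Category.{v} C] [DuoidalCategory C] : unitI C ⟶ unitJ C :=
  counitB (unitI C)

/-- A bimonoid in a duoidal category: a monoid for `∘` and a comonoid for `•`, subject to the
four compatibility axioms. -/
class IsBimonoid (A : C) [CircMon A] [BullComon A] : Prop where
  mul_comul : mulC A ≫ comulB A =
    (comulB A ⊚ₘ comulB A) ≫ zeta A A A A ≫ (mulC A ●ₘ mulC A)
  mul_counit : mulC A ≫ counitB A = (counitB A ⊚ₘ counitB A) ≫ mulC (unitJ C)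
  one_comul : oneC A ≫ comulB A = comulB (unitI C) ≫ (oneC A ●ₘ oneC A)
  one_counit : oneC A ≫ counitB A = tau C

/-- The unit `I` is a bimonoid. -/
instance isBimonoidUnitI : IsBimonoid (unitI C) where
  mul_comul := by
    have h : comulB (unitI C) ⊚ₘ comulB (unitI C) =
        (𝟙 (unitI C) ⊚ₘ comulB (unitI C)) ≫ (comulB (unitI C) ⊚ₘ 𝟙 _) := by
      rw [circ_comp, Category.id_comp, Category.comp_id]
    rw [mulC_unitI, h, Category.assoc, left_unit_circ, lC_nat]
  mul_counit := by
    have h : counitB (unitI C) ⊚ₘ counitB (unitI C) =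
        (𝟙 (unitI C) ⊚ₘ counitB (unitI C)) ≫ (oneC (unitJ C) ⊚ₘ 𝟙 _) := by
      rw [circ_comp, Category.id_comp, Category.comp_id, one_eq_counit]
    rw [mulC_unitI, h, Category.assoc, one_mulC, lC_nat]
  one_comul := by
    rw [oneC_unitI, Category.id_comp, bull_id, Category.comp_id]
  one_counit := by rw [oneC_unitI, Category.id_comp]

/-- The functor `(-) ∘ A`. -/
abbrev circRight (A : C) : C ⥤ C where
  obj X := X ⊚ A
  map f := f ⊚ₘ 𝟙 A
  map_id X := circ_id X A
  map_comp f g := by rw [circ_comp, Category.comp_id]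

/-- The functor `(-) • A`. -/
abbrev bullRight (A : C) : C ⥤ C where
  obj X := X ● A
  map f := f ●ₘ 𝟙 A
  map_id X := bull_id X A
  map_comp f g := by rw [bull_comp, Category.comp_id]

/-- The monad `(-) ∘ A` of a monoid `A` in `(C, ∘, I)`. -/
abbrev circMonad (A : C) [CircMon A] : Monad C where
  toFunctor := circRight A
  η := { app := fun X => (rC X).inv ≫ (𝟙 X ⊚ₘ oneC A)
         naturality := by
          intro X Y f
          dsimp only [Functor.id_obj, Functor.id_map]
          rw [← Category.assoc, rC_inv_nat, Category.assoc, Category.assoc, circ_comp, circ_comp]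
          simp only [Category.id_comp, Category.comp_id] }
  μ := { app := fun X => (aC X A A).hom ≫ (𝟙 X ⊚ₘ mulC A)
         naturality := by
          intro X Y f
          dsimp only [Functor.comp_obj, Functor.comp_map]
          rw [← Category.assoc, aC_nat, Category.assoc, Category.assoc, circ_comp, circ_comp,
            circ_id]
          simp only [Category.id_comp, Category.comp_id] }
  assoc X := by
    dsimp only
    have h1 : (((aC X A A).hom ≫ (𝟙 X ⊚ₘ mulC A)) ⊚ₘ 𝟙 A) =
        ((aC X A A).hom ⊚ₘ 𝟙 A) ≫ ((𝟙 X ⊚ₘ mulC A) ⊚ₘ 𝟙 A) := by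
      rw [circ_comp, Category.comp_id]
    have h2 : 𝟙 ((X ⊚ A) : C) ⊚ₘ mulC A = (𝟙 X ⊚ₘ 𝟙 A) ⊚ₘ mulC A := by rw [circ_id]
    rw [h1, Category.assoc, ← Category.assoc (_ ⊚ₘ _) (aC X A A).hom, aC_nat, Category.assoc,
      circ_comp, mul_assocC, h2, Category.assoc, ← Category.assoc (_ ⊚ₘ _) (aC X A A).hom,
      aC_nat, Category.assoc, circ_comp, ← Category.assoc (aC (X ⊚ A) A A).hom, ← pentagonC]
    simp only [Category.assoc, circ_comp, Category.comp_id]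
  left_unit X := by
    dsimp only [Functor.id_obj]
    have h2 : 𝟙 ((X ⊚ A) : C) ⊚ₘ oneC A = (𝟙 X ⊚ₘ 𝟙 A) ⊚ₘ oneC A := by rw [circ_id]
    rw [h2, Category.assoc, ← Category.assoc (_ ⊚ₘ _) (aC X A A).hom, aC_nat, Category.assoc,
      circ_comp, mul_oneC, Category.comp_id, rC_tensor, Iso.inv_hom_id]
  right_unit X := by
    dsimp only [Functor.id_obj]
    have h1 : (((rC X).inv ≫ (𝟙 X ⊚ₘ oneC A)) ⊚ₘ 𝟙 A) =
        ((rC X).inv ⊚ₘ 𝟙 A) ≫ ((𝟙 X ⊚ₘ oneC A) ⊚ₘ 𝟙 A) := by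
      rw [circ_comp, Category.comp_id]
    rw [h1, Category.assoc, ← Category.assoc (_ ⊚ₘ _) (aC X A A).hom, aC_nat, Category.assoc,
      circ_comp, one_mulC, Category.comp_id, triangleC, circ_comp, Iso.inv_hom_id,
      Category.comp_id, circ_id]

/-- The comonad `(-) • A` of a comonoid `A` in `(C, •, J)`. -/
abbrev bullComonad (A : C) [BullComon A] : Comonad C where
  toFunctor := bullRight A
  ε := { app := fun X => (𝟙 X ●ₘ counitB A) ≫ (rB X).hom
         naturality := by
          intro X Y f
          dsimp only [Functor.id_obj, Functor.id_map]
          rw [Category.assoc, ← rB_nat, ← Category.assoc, ← Category.assoc, bull_comp, bull_comp]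
          simp only [Category.id_comp, Category.comp_id] }
  δ := { app := fun X => (𝟙 X ●ₘ comulB A) ≫ (aB X A A).inv
         naturality := by
          intro X Y f
          dsimp only [Functor.comp_obj, Functor.comp_map]
          rw [Category.assoc, ← aB_inv_nat, ← Category.assoc, ← Category.assoc, bull_comp,
            bull_comp, bull_id]
          simp only [Category.id_comp, Category.comp_id] }
  coassoc X := by
    dsimp only
    have h1 : (((𝟙 X ●ₘ comulB A) ≫ (aB X A A).inv) ●ₘ 𝟙 A) =
        ((𝟙 X ●ₘ comulB A) ●ₘ 𝟙 A) ≫ ((aB X A A).inv ●ₘ 𝟙 A) := by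
      rw [bull_comp, Category.comp_id]
    have h2 : 𝟙 ((X ● A) : C) ●ₘ comulB A = (𝟙 X ●ₘ 𝟙 A) ●ₘ comulB A := by rw [bull_id]
    have h3 : ((aB X A A).inv ●ₘ 𝟙 A) ≫ ((aB X A A).hom ●ₘ 𝟙 A) = 𝟙 _ := by
      rw [bull_comp, Iso.inv_hom_id, Category.comp_id, bull_id]
    have h4 : (aB X (A ● A) A).inv ≫ ((aB X A A).inv ●ₘ 𝟙 A) =
        (𝟙 X ●ₘ (aB A A A).hom) ≫ (aB X A (A ● A)).inv ≫ (aB (X ● A) A A).inv := by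
      rw [← cancel_mono (aB (X ● A) A A).hom, ← cancel_mono (aB X A (A ● A)).hom]
      simp only [Category.assoc, Iso.inv_hom_id, Category.comp_id]
      rw [← pentagonB, ← Category.assoc (_ ●ₘ _) (_ ●ₘ _), h3, Category.id_comp,
        Iso.inv_hom_id_assoc]
    have hL : ((𝟙 X ●ₘ comulB A) ≫ (aB X A A).inv) ≫
        (((𝟙 X ●ₘ comulB A) ≫ (aB X A A).inv) ●ₘ 𝟙 A) =
        (𝟙 X ●ₘ (comulB A ≫ (comulB A ●ₘ 𝟙 A) ≫ (aB A A A).hom)) ≫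
          (aB X A (A ● A)).inv ≫ (aB (X ● A) A A).inv := by
      rw [h1, Category.assoc, ← Category.assoc (aB X A A).inv, ← aB_inv_nat, Category.assoc, h4,
        ← Category.assoc, ← Category.assoc, bull_comp, bull_comp]
      simp only [Category.assoc, Category.comp_id]
    rw [hL, h2, Category.assoc, ← Category.assoc (aB X A A).inv, ← aB_inv_nat, Category.assoc,
      ← Category.assoc (_ ●ₘ _) (_ ●ₘ _), bull_comp, comul_assocB, Category.comp_id]
  left_counit X := by
    dsimp only [Functor.id_obj]
    have h2 : 𝟙 ((X ● A) : C) ●ₘ counitB A = (𝟙 X ●ₘ 𝟙 A) ●ₘ counitB A := by rw [bull_id]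
    rw [h2, Category.assoc, ← Category.assoc (aB X A A).inv, ← aB_inv_nat, Category.assoc,
      ← rB_tensor, Iso.inv_hom_id_assoc, bull_comp, bull_comp]
    simp only [Category.comp_id, comul_counitB, bull_id]
  right_counit X := by
    dsimp only [Functor.id_obj]
    have h1 : (((𝟙 X ●ₘ counitB A) ≫ (rB X).hom) ●ₘ 𝟙 A) =
        ((𝟙 X ●ₘ counitB A) ●ₘ 𝟙 A) ≫ ((rB X).hom ●ₘ 𝟙 A) := by
      rw [bull_comp, Category.comp_id]
    rw [h1, Category.assoc, ← Category.assoc (aB X A A).inv, ← aB_inv_nat, Category.assoc,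
      ← triangleB, Iso.inv_hom_id_assoc, bull_comp, bull_comp]
    simp only [Category.comp_id, counit_comulB, bull_id]

/-- The category `M_A` of right modules over a monoid `A` in `(C, ∘, I)`. -/
abbrev RightMod (A : C) [CircMon A] := (circMonad A).Algebra

/-- The category `M^A` of right comodules over a comonoid `A` in `(C, •, J)`. -/
abbrev RightComod (A : C) [BullComon A] := (bullComonad A).Coalgebra

section Modules

variable {A B : C} [CircMon A] [CircMon B]

theorem mod_unit {B : C} [CircMon B] (P : RightMod B) : (𝟙 P.A ⊚ₘ oneC B) ≫ P.a = (rC P.A).hom := by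
  rw [← cancel_epi (rC P.A).inv, Iso.inv_hom_id, ← Category.assoc]
  exact P.unit

theorem mod_assoc {B : C} [CircMon B] (P : RightMod B) :
    (P.a ⊚ₘ 𝟙 B) ≫ P.a = (aC P.A B B).hom ≫ (𝟙 P.A ⊚ₘ mulC B) ≫ P.a := by
  rw [← Category.assoc (aC P.A B B).hom]
  exact P.assoc.symm

theorem comod_counit {A : C} [BullComon A] (Z : RightComod A) :
    Z.a ≫ (𝟙 Z.A ●ₘ counitB A) ≫ (rB Z.A).hom = 𝟙 Z.A :=
  Z.counit

theorem comod_coassoc {A : C} [BullComon A] (Z : RightComod A) :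
    Z.a ≫ (𝟙 Z.A ●ₘ comulB A) = Z.a ≫ (Z.a ●ₘ 𝟙 A) ≫ (aB Z.A A A).hom := by
  have h : Z.a ≫ (𝟙 Z.A ●ₘ comulB A) ≫ (aB Z.A A A).inv = Z.a ≫ (Z.a ●ₘ 𝟙 A) := Z.coassoc
  rw [← Category.assoc Z.a (Z.a ●ₘ 𝟙 A), ← h]
  simp only [Category.assoc, Iso.inv_hom_id, Category.comp_id]

/-- Restriction of scalars `ω^* : M_B ⥤ M_A`, on objects: the action of `A` on a `B`-module is
obtained by composing with the monoid morphism `ω : A ⟶ B`. -/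
abbrev restrictMod (ω : A ⟶ B) (hω : IsCircMonHom ω) (Q : RightMod B) : RightMod A where
  A := Q.A
  a := (𝟙 Q.A ⊚ₘ ω) ≫ Q.a
  unit := by
    have h : oneC A ≫ ω = oneC B := hω.one_hom
    dsimp only
    rw [Category.assoc, ← Category.assoc (_ ⊚ₘ _) (_ ⊚ₘ _), circ_comp, h, Category.comp_id,
      mod_unit, Iso.inv_hom_id]
    rfl
  assoc := by
    have h : mulC A ≫ ω = (ω ⊚ₘ ω) ≫ mulC B := hω.mul_hom
    have h1 : ((𝟙 Q.A ⊚ₘ ω) ≫ Q.a) ⊚ₘ 𝟙 A = ((𝟙 Q.A ⊚ₘ ω) ⊚ₘ 𝟙 A) ≫ (Q.a ⊚ₘ 𝟙 A) := by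
      rw [circ_comp, Category.comp_id]
    have h2 : (Q.a ⊚ₘ 𝟙 A) ≫ (𝟙 Q.A ⊚ₘ ω) =
        ((𝟙 Q.A ⊚ₘ 𝟙 B) ⊚ₘ ω) ≫ (Q.a ⊚ₘ 𝟙 B) := by
      rw [circ_id]
      simp only [circ_comp, Category.comp_id, Category.id_comp]
    dsimp only
    rw [h1, Category.assoc, Category.assoc, ← Category.assoc (Q.a ⊚ₘ 𝟙 A), h2, Category.assoc,
      mod_assoc, circ_comp_assoc, circ_comp_assoc, circ_comp, reassoc_of% aC_nat, circ_comp_assoc]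
    simp only [Category.id_comp, Category.comp_id, h]

end Modules

section ComoduleMonoids

variable (A B : C) [CircMon A] [BullComon A] [IsBimonoid A] [CircMon B]

/-- The structure of a right comodule monoid over the bimonoid `A` on a monoid `B`: a coassociative
and counital coaction for which the multiplication and the unit of `B` are colinear. -/
structure ComoduleMonoid where
  coact : B ⟶ B ● A
  counit : coact ≫ (𝟙 B ●ₘ counitB A) ≫ (rB B).hom = 𝟙 B
  coassoc : coact ≫ (𝟙 B ●ₘ comulB A) = coact ≫ (coact ●ₘ 𝟙 A) ≫ (aB B A A).hom
  mul_coact : mulC B ≫ coact = (coact ⊚ₘ coact) ≫ zeta B A B A ≫ (mulC B ●ₘ mulC A)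
  one_coact : oneC B ≫ coact = comulB (unitI C) ≫ (oneC B ●ₘ oneC A)

/-- A bimonoid is a comodule monoid over itself through its comultiplication. -/
abbrev ComoduleMonoid.regular : ComoduleMonoid A A where
  coact := comulB A
  counit := comul_counitB A
  coassoc := comul_assocB A
  mul_coact := IsBimonoid.mul_comul
  one_coact := IsBimonoid.one_comul

end ComoduleMonoids

section Relative

variable {A B : C} [CircMon A] [BullComon A] [IsBimonoid A] [CircMon B]

/-- The comodule underlying a comodule monoid. -/
abbrev ComoduleMonoid.comod (R : ComoduleMonoid A B) : RightComod A where
  A := B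
  a := R.coact
  counit := R.counit
  coassoc := by
    dsimp only
    rw [← Category.assoc, R.coassoc]
    simp only [Category.assoc, Iso.hom_inv_id, Category.comp_id]

/-- `(A, B)`-relative Hopf modules: right `B`-modules with a coassociative and counital
`A`-coaction, compatible with the action. -/
structure HopfModule (R : ComoduleMonoid A B) where
  mod : RightMod B
  coact : mod.A ⟶ mod.A ● A
  counit : coact ≫ (𝟙 mod.A ●ₘ counitB A) ≫ (rB mod.A).hom = 𝟙 mod.A
  coassoc : coact ≫ (𝟙 mod.A ●ₘ comulB A) = coact ≫ (coact ●ₘ 𝟙 A) ≫ (aB mod.A A A).hom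
  compat : mod.a ≫ coact = (coact ⊚ₘ R.coact) ≫ zeta mod.A A B A ≫ (mod.a ●ₘ mulC A)

/-- Morphisms of relative Hopf modules: morphisms of `B`-modules which are also morphisms of
`A`-comodules. -/
@[ext]
structure HopfModule.Hom {R : ComoduleMonoid A B} (X Y : HopfModule R) where
  f : X.mod.A ⟶ Y.mod.A
  act_comp : X.mod.a ≫ f = (f ⊚ₘ 𝟙 B) ≫ Y.mod.a
  comp_coact : f ≫ Y.coact = X.coact ≫ (f ●ₘ 𝟙 A)

/-- The category `M^A_B` of relative Hopf modules. -/
instance HopfModule.category (R : ComoduleMonoid A B) : Category (HopfModule R) where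
  Hom X Y := HopfModule.Hom X Y
  id X :=
    { f := 𝟙 X.mod.A
      act_comp := by rw [circ_id, Category.comp_id, Category.id_comp]
      comp_coact := by rw [bull_id, Category.comp_id, Category.id_comp] }
  comp g h :=
    { f := g.f ≫ h.f
      act_comp := by
        rw [← Category.assoc, g.act_comp, Category.assoc, h.act_comp, ← Category.assoc, circ_comp,
          Category.comp_id]
      comp_coact := by
        rw [Category.assoc, h.comp_coact, ← Category.assoc, g.comp_coact, Category.assoc,
          bull_comp, Category.comp_id] }

/-- The lifting of the comonad `(-) • A` to `B`-modules, on objects: the module `P • A` with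
`B`-action `(P • A) ∘ B ⟶ (P • A) ∘ (B • A) ⟶ (P ∘ B) • (A ∘ A) ⟶ P • A`. -/
abbrev bullMod (R : ComoduleMonoid A B) (P : RightMod B) : RightMod B where
  A := P.A ● A
  a := (𝟙 (P.A ● A) ⊚ₘ R.coact) ≫ zeta P.A A B A ≫ (P.a ●ₘ mulC A)
  unit := by
    have h : 𝟙 (P.A ● A) ⊚ₘ (comulB (unitI C) ≫ (oneC B ●ₘ oneC A)) =
        (𝟙 (P.A ● A) ⊚ₘ comulB (unitI C)) ≫
          ((𝟙 P.A ●ₘ 𝟙 A) ⊚ₘ (oneC B ●ₘ oneC A)) := by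
      rw [circ_comp, bull_id, Category.comp_id]
    dsimp only
    rw [Category.assoc, ← Category.assoc (_ ⊚ₘ _) (_ ⊚ₘ _), circ_comp, R.one_coact,
      Category.comp_id, h, Category.assoc, ← Category.assoc (_ ⊚ₘ _) (zeta _ _ _ _), zeta_natural,
      Category.assoc, bull_comp, mod_unit, mul_oneC, right_unit_circ, Iso.inv_hom_id]
    rfl
  assoc := by
    have e1 : 𝟙 (P.A ● A) ⊚ₘ (mulC B ≫ R.coact) =
        (𝟙 (P.A ● A) ⊚ₘ (R.coact ⊚ₘ R.coact)) ≫ (𝟙 (P.A ● A) ⊚ₘ zeta B A B A) ≫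
          ((𝟙 P.A ●ₘ 𝟙 A) ⊚ₘ (mulC B ●ₘ mulC A)) := by
      rw [R.mul_coact, circ_comp, circ_comp, bull_id, Category.comp_id, Category.comp_id]
    have e2 : (((𝟙 (P.A ● A) ⊚ₘ R.coact) ≫ zeta P.A A B A ≫ (P.a ●ₘ mulC A)) ⊚ₘ 𝟙 B) ≫
        (𝟙 (P.A ● A) ⊚ₘ R.coact) =
        ((𝟙 (P.A ● A) ⊚ₘ R.coact) ⊚ₘ R.coact) ≫ (zeta P.A A B A ⊚ₘ 𝟙 (B ● A)) ≫
          ((P.a ●ₘ mulC A) ⊚ₘ (𝟙 B ●ₘ 𝟙 A)) := by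
      simp only [circ_comp, bull_id, Category.comp_id, Category.id_comp]
    dsimp only
    rw [← Category.assoc (_ ⊚ₘ 𝟙 B), e2, Category.assoc, ← Category.assoc (_ ⊚ₘ _) (_ ⊚ₘ _),
      circ_comp, Category.comp_id, e1]
    simp only [Category.assoc]
    rw [← Category.assoc (_ ⊚ₘ _) (zeta _ _ _ _), zeta_natural,
      ← Category.assoc (_ ⊚ₘ (_ ●ₘ _)) (zeta _ _ _ _), zeta_natural]
    simp only [Category.assoc, bull_comp]
    rw [mod_assoc, mul_assocC, ← bull_comp (aC _ _ _).hom (aC _ _ _).hom,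
      reassoc_of% zeta_assoc_circ, reassoc_of% aC_nat]

/-- The comparison functor `K = (-) ∘ B : M^I ⥤ M^A_B`. The action on `Z ∘ B` is that of the
free module, the coaction is the composite
`Z ∘ B ⟶ (Z • I) ∘ (B • A) ⟶ (Z ∘ B) • (I ∘ A) ⟶ (Z ∘ B) • A`. -/
abbrev comparison (R : ComoduleMonoid A B) : RightComod (unitI C) ⥤ HopfModule R where
  obj Z :=
    { mod := (circMonad B).free.obj Z.A
      coact := (Z.a ⊚ₘ R.coact) ≫ zeta Z.A (unitI C) B A ≫ (𝟙 (Z.A ⊚ B) ●ₘ (lC A).hom)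
      counit := by
        have h : (lC A).hom ≫ counitB A = (counitB (unitI C) ⊚ₘ counitB A) ≫ mulC (unitJ C) := by
          rw [← lC_nat, ← one_mulC, circ_comp_assoc, Category.id_comp, Category.comp_id,
            one_eq_counit]
        have h2 : zeta Z.A (unitI C) B A ≫ (𝟙 (Z.A ⊚ B) ●ₘ (counitB (unitI C) ⊚ₘ counitB A)) =
            ((𝟙 Z.A ●ₘ counitB (unitI C)) ⊚ₘ (𝟙 B ●ₘ counitB A)) ≫ zeta _ _ _ _ := by
          rw [zeta_natural, circ_id]
        have h3 : 𝟙 (Z.A ⊚ B) ●ₘ ((counitB (unitI C) ⊚ₘ counitB A) ≫ mulC (unitJ C)) =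
            (𝟙 (Z.A ⊚ B) ●ₘ (counitB (unitI C) ⊚ₘ counitB A)) ≫
              (𝟙 (Z.A ⊚ B) ●ₘ mulC (unitJ C)) := by
          rw [bull_comp, Category.comp_id]
        change ((Z.a ⊚ₘ R.coact) ≫ zeta Z.A (unitI C) B A ≫ (𝟙 (Z.A ⊚ B) ●ₘ (lC A).hom)) ≫
          (𝟙 (Z.A ⊚ B) ●ₘ counitB A) ≫ (rB (Z.A ⊚ B)).hom = 𝟙 (Z.A ⊚ B)
        simp only [Category.assoc]
        rw [bull_comp_assoc, Category.comp_id, h, h3, Category.assoc, reassoc_of% h2,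
          right_unit_bull, circ_comp, circ_comp, comod_counit, R.counit, circ_id]
      coassoc := by
        have h : (lC A).hom ≫ comulB A = (comulB (unitI C) ⊚ₘ comulB A) ≫
            zeta (unitI C) (unitI C) A A ≫ ((lC A).hom ●ₘ (lC A).hom) := by
          rw [← lC_nat, ← left_unit_circ, circ_comp_assoc, Category.id_comp, Category.comp_id]
        have h1 : 𝟙 (Z.A ⊚ B) ●ₘ ((lC A).hom ≫ comulB A) =
            ((𝟙 Z.A ⊚ₘ 𝟙 B) ●ₘ (comulB (unitI C) ⊚ₘ comulB A)) ≫
              (𝟙 (Z.A ⊚ B) ●ₘ zeta (unitI C) (unitI C) A A) ≫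
                (𝟙 (Z.A ⊚ B) ●ₘ ((lC A).hom ●ₘ (lC A).hom)) := by
          rw [h, circ_id, bull_comp, bull_comp, Category.comp_id, Category.comp_id]
        have h2 : (𝟙 (Z.A ⊚ B) ●ₘ (lC A).hom) ≫
            (((Z.a ⊚ₘ R.coact) ≫ zeta Z.A (unitI C) B A ≫
              (𝟙 (Z.A ⊚ B) ●ₘ (lC A).hom)) ●ₘ 𝟙 A) =
            ((Z.a ⊚ₘ R.coact) ●ₘ (𝟙 (unitI C) ⊚ₘ 𝟙 A)) ≫
              (zeta Z.A (unitI C) B A ●ₘ 𝟙 (unitI C ⊚ A)) ≫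
                ((𝟙 (Z.A ⊚ B) ●ₘ (lC A).hom) ●ₘ (lC A).hom) := by
          simp only [bull_comp, circ_id, Category.id_comp, Category.comp_id]
        change ((Z.a ⊚ₘ R.coact) ≫ zeta Z.A (unitI C) B A ≫ (𝟙 (Z.A ⊚ B) ●ₘ (lC A).hom)) ≫
            (𝟙 (Z.A ⊚ B) ●ₘ comulB A) =
          ((Z.a ⊚ₘ R.coact) ≫ zeta Z.A (unitI C) B A ≫ (𝟙 (Z.A ⊚ B) ●ₘ (lC A).hom)) ≫
            (((Z.a ⊚ₘ R.coact) ≫ zeta Z.A (unitI C) B A ≫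
              (𝟙 (Z.A ⊚ B) ●ₘ (lC A).hom)) ●ₘ 𝟙 A) ≫ (aB (Z.A ⊚ B) A A).hom
        simp only [Category.assoc]
        rw [bull_comp, Category.comp_id, h1, ← reassoc_of% zeta_natural, circ_comp_assoc,
          comod_coassoc, R.coassoc, reassoc_of% h2, aB_nat, ← reassoc_of% zeta_natural,
          reassoc_of% zeta_assoc_bull]
        simp only [circ_comp_assoc]
      compat := by
        have h : ((lC A).hom ⊚ₘ 𝟙 A) ≫ mulC A =
            (aC (unitI C) A A).hom ≫ (𝟙 (unitI C) ⊚ₘ mulC A) ≫ (lC A).hom := by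
          rw [lC_nat, ← lC_tensor, Category.assoc]
        have h1 : (𝟙 Z.A ⊚ₘ mulC B) ≫ (Z.a ⊚ₘ R.coact) =
            (Z.a ⊚ₘ (R.coact ⊚ₘ R.coact)) ≫ (𝟙 (Z.A ● unitI C) ⊚ₘ zeta B A B A) ≫
              ((𝟙 Z.A ●ₘ 𝟙 (unitI C)) ⊚ₘ (mulC B ●ₘ mulC A)) := by
          simp only [circ_comp, bull_id, Category.id_comp, Category.comp_id, R.mul_coact]
        have h2 : ((Z.a ⊚ₘ R.coact) ≫ zeta Z.A (unitI C) B A ≫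
            (𝟙 (Z.A ⊚ B) ●ₘ (lC A).hom)) ⊚ₘ R.coact =
            ((Z.a ⊚ₘ R.coact) ⊚ₘ R.coact) ≫ (zeta Z.A (unitI C) B A ⊚ₘ 𝟙 (B ● A)) ≫
              ((𝟙 (Z.A ⊚ B) ●ₘ (lC A).hom) ⊚ₘ (𝟙 B ●ₘ 𝟙 A)) := by
          simp only [circ_comp, bull_id, Category.comp_id]
        change ((aC Z.A B B).hom ≫ (𝟙 Z.A ⊚ₘ mulC B)) ≫ (Z.a ⊚ₘ R.coact) ≫
            zeta Z.A (unitI C) B A ≫ (𝟙 (Z.A ⊚ B) ●ₘ (lC A).hom) =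
          (((Z.a ⊚ₘ R.coact) ≫ zeta Z.A (unitI C) B A ≫
            (𝟙 (Z.A ⊚ B) ●ₘ (lC A).hom)) ⊚ₘ R.coact) ≫ zeta (Z.A ⊚ B) A B A ≫
              (((aC Z.A B B).hom ≫ (𝟙 Z.A ⊚ₘ mulC B)) ●ₘ mulC A)
        rw [h2]
        simp only [Category.assoc]
        rw [reassoc_of% h1, reassoc_of% zeta_natural, reassoc_of% zeta_natural, bull_comp,
          bull_comp, h, circ_id, Category.id_comp, Category.comp_id,
          ← bull_comp (aC _ _ _).hom (aC _ _ _).hom, reassoc_of% zeta_assoc_circ,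
          reassoc_of% aC_nat] }
  map g :=
    { f := g.f ⊚ₘ 𝟙 B
      act_comp := by
        change ((aC _ B B).hom ≫ (𝟙 _ ⊚ₘ mulC B)) ≫ (g.f ⊚ₘ 𝟙 B) =
          ((g.f ⊚ₘ 𝟙 B) ⊚ₘ 𝟙 B) ≫ (aC _ B B).hom ≫ (𝟙 _ ⊚ₘ mulC B)
        rw [reassoc_of% aC_nat, Category.assoc, circ_comp, circ_comp, circ_id]
        simp only [Category.id_comp, Category.comp_id]
      comp_coact := by
        rename_i Z Z'
        have h : g.f ≫ Z'.a = Z.a ≫ (g.f ●ₘ 𝟙 (unitI C)) := g.h.symm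
        have h1 : (g.f ⊚ₘ 𝟙 B) ≫ (Z'.a ⊚ₘ R.coact) =
            (Z.a ⊚ₘ R.coact) ≫ ((g.f ●ₘ 𝟙 (unitI C)) ⊚ₘ (𝟙 B ●ₘ 𝟙 A)) := by
          rw [circ_comp, circ_comp, h, bull_id, Category.id_comp, Category.comp_id]
        change (g.f ⊚ₘ 𝟙 B) ≫ (Z'.a ⊚ₘ R.coact) ≫ zeta Z'.A (unitI C) B A ≫
            (𝟙 (Z'.A ⊚ B) ●ₘ (lC A).hom) =
          ((Z.a ⊚ₘ R.coact) ≫ zeta Z.A (unitI C) B A ≫ (𝟙 (Z.A ⊚ B) ●ₘ (lC A).hom)) ≫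
            ((g.f ⊚ₘ 𝟙 B) ●ₘ 𝟙 A)
        simp only [Category.assoc]
        rw [reassoc_of% h1, reassoc_of% zeta_natural, bull_comp, bull_comp, circ_id]
        simp only [Category.id_comp, Category.comp_id] }
  map_id Z := HopfModule.Hom.ext (circ_id _ _)
  map_comp g h := HopfModule.Hom.ext (by
    change (g.f ≫ h.f) ⊚ₘ 𝟙 B = (g.f ⊚ₘ 𝟙 B) ≫ (h.f ⊚ₘ 𝟙 B)
    rw [circ_comp, Category.comp_id])

end Relative

section Coinvariants

variable {A B : C} [CircMon A] [BullComon A] [IsBimonoid A] [CircMon B]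

/-- A comodule monoid as a relative Hopf module over itself. -/
abbrev ComoduleMonoid.hopf (R : ComoduleMonoid A B) : HopfModule R where
  mod :=
    { A := B
      a := mulC B
      unit := by
        dsimp only
        rw [Category.assoc, mul_oneC, Iso.inv_hom_id]
        rfl
      assoc := by
        dsimp only
        rw [Category.assoc, mul_assocC] }
  coact := R.coact
  counit := R.counit
  coassoc := R.coassoc
  compat := R.mul_coact

/-- The morphism `φ⁰ = ρ • I : X • I ⟶ (X • A) • I` of cofree `I`-comodules. -/
abbrev phi0 {R : ComoduleMonoid A B} (X : HopfModule R) :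
    (bullComonad (unitI C)).cofree.obj X.mod.A ⟶
      (bullComonad (unitI C)).cofree.obj (X.mod.A ● A) :=
  (bullComonad (unitI C)).cofree.map X.coact

/-- The morphism `φ¹ : X • I ⟶ X • (I • I) ≅ (X • I) • I ⟶ (X • A) • I` of cofree `I`-comodules,
built from `δ` and the unit `η : I ⟶ A`. -/
abbrev phi1 {R : ComoduleMonoid A B} (X : HopfModule R) :
    (bullComonad (unitI C)).cofree.obj X.mod.A ⟶
      (bullComonad (unitI C)).cofree.obj (X.mod.A ● A) where
  f := (𝟙 X.mod.A ●ₘ comulB (unitI C)) ≫ (aB X.mod.A (unitI C) (unitI C)).inv ≫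
    ((𝟙 X.mod.A ●ₘ oneC A) ●ₘ 𝟙 (unitI C))
  h := by
    have h1 := (bullComonad (unitI C)).coassoc X.mod.A
    have h2 := (bullComonad (unitI C)).δ.naturality (𝟙 X.mod.A ●ₘ oneC A)
    dsimp only [Functor.comp_map, Functor.comp_obj] at h1 h2
    change ((𝟙 X.mod.A ●ₘ comulB (unitI C)) ≫ (aB _ _ _).inv) ≫
        (((𝟙 X.mod.A ●ₘ comulB (unitI C)) ≫ (aB _ _ _).inv ≫
          ((𝟙 X.mod.A ●ₘ oneC A) ●ₘ 𝟙 (unitI C))) ●ₘ 𝟙 (unitI C)) =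
      ((𝟙 X.mod.A ●ₘ comulB (unitI C)) ≫ (aB _ _ _).inv ≫
        ((𝟙 X.mod.A ●ₘ oneC A) ●ₘ 𝟙 (unitI C))) ≫
          (𝟙 (X.mod.A ● A) ●ₘ comulB (unitI C)) ≫ (aB _ _ _).inv
    have h3 : (((𝟙 X.mod.A ●ₘ comulB (unitI C)) ≫ (aB _ _ _).inv ≫
        ((𝟙 X.mod.A ●ₘ oneC A) ●ₘ 𝟙 (unitI C))) ●ₘ 𝟙 (unitI C)) =
        (((𝟙 X.mod.A ●ₘ comulB (unitI C)) ≫ (aB _ _ _).inv) ●ₘ 𝟙 (unitI C)) ≫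
          (((𝟙 X.mod.A ●ₘ oneC A) ●ₘ 𝟙 (unitI C)) ●ₘ 𝟙 (unitI C)) := by
      rw [bull_comp, Category.comp_id, Category.assoc]
    simp only [Category.assoc] at h1 h2 ⊢
    rw [← Category.assoc (𝟙 X.mod.A ●ₘ comulB (unitI C))] at h3
    simp only [Category.assoc] at h3
    rw [h3, reassoc_of% h1, h2]

/-- A morphism of comodules from `Z` to the cofree comodule `X • A`. -/
abbrev cofreeHom (Z : RightComod A) {X : C} (i : Z.A ⟶ X ● A)
    (h : i ≫ (𝟙 X ●ₘ comulB A) ≫ (aB X A A).inv = Z.a ≫ (i ●ₘ 𝟙 A)) :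
    Z ⟶ (bullComonad A).cofree.obj X where
  f := i
  h := h.symm

/-- The coinvariant part of the comodule monoid `B`, for a candidate `D`. The monoid `D` is a monoid
in the category of `I`-comodules (the datum `S`), `ι : D ⟶ B • I` is an equalizer of `φ⁰` and `φ¹`
for `B` in the category of `I`-comodules, and the unit and the multiplication of `D` are induced
by those of the monoid `B • I`. -/
structure CoinvariantPart (R : ComoduleMonoid A B) {D : C} [CircMon D]
    (S : ComoduleMonoid (unitI C) D) where
  ι : D ⟶ B ● unitI C
  colinear : ι ≫ (𝟙 B ●ₘ comulB (unitI C)) ≫ (aB B (unitI C) (unitI C)).inv =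
    S.coact ≫ (ι ●ₘ 𝟙 (unitI C))
  condition : cofreeHom S.comod ι colinear ≫ phi0 R.hopf =
    cofreeHom S.comod ι colinear ≫ phi1 R.hopf
  isLimit : IsLimit (Fork.ofι (cofreeHom S.comod ι colinear) condition)
  one_ι : oneC D ≫ ι = comulB (unitI C) ≫ (oneC B ●ₘ 𝟙 (unitI C))
  mul_ι : mulC D ≫ ι = (ι ⊚ₘ ι) ≫ zeta B (unitI C) B (unitI C) ≫
    (mulC B ●ₘ (lC (unitI C)).hom)

/-- The morphism `ω : D ⟶ B • I ⟶ B • J ≅ B` from the coinvariant part to `B`. -/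
abbrev CoinvariantPart.omega {R : ComoduleMonoid A B} {D : C} [CircMon D]
    {S : ComoduleMonoid (unitI C) D} (P : CoinvariantPart R S) : D ⟶ B :=
  P.ι ≫ (𝟙 B ●ₘ tau C) ≫ (rB B).hom

/-- The natural transformation
`β⁰_Q : (Q • I) ∘ B ⟶ (Q • I) ∘ (B • A) ⟶ (Q ∘ B) • (I ∘ A) ≅ (Q ∘ B) • A ⟶ Q • A`,
for right `B`-modules `Q`. -/
abbrev beta0 (R : ComoduleMonoid A B) :
    (circMonad B).forget ⋙ bullRight (unitI C) ⋙ circRight B ⟶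
      (circMonad B).forget ⋙ bullRight A where
  app Q := (𝟙 (Q.A ● unitI C) ⊚ₘ R.coact) ≫ zeta Q.A (unitI C) B A ≫
    (𝟙 (Q.A ⊚ B) ●ₘ (lC A).hom) ≫ (Q.a ●ₘ 𝟙 A)
  naturality := by
    intro Q Q' f
    have h : (f.f ⊚ₘ 𝟙 B) ≫ Q'.a = Q.a ≫ f.f := f.h
    change ((f.f ●ₘ 𝟙 (unitI C)) ⊚ₘ 𝟙 B) ≫ (𝟙 (Q'.A ● unitI C) ⊚ₘ R.coact) ≫
        zeta Q'.A (unitI C) B A ≫ (𝟙 (Q'.A ⊚ B) ●ₘ (lC A).hom) ≫ (Q'.a ●ₘ 𝟙 A) =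
      ((𝟙 (Q.A ● unitI C) ⊚ₘ R.coact) ≫ zeta Q.A (unitI C) B A ≫
        (𝟙 (Q.A ⊚ B) ●ₘ (lC A).hom) ≫ (Q.a ●ₘ 𝟙 A)) ≫ (f.f ●ₘ 𝟙 A)
    have h1 : ((f.f ●ₘ 𝟙 (unitI C)) ⊚ₘ 𝟙 B) ≫ (𝟙 (Q'.A ● unitI C) ⊚ₘ R.coact) =
        (𝟙 (Q.A ● unitI C) ⊚ₘ R.coact) ≫ ((f.f ●ₘ 𝟙 (unitI C)) ⊚ₘ (𝟙 B ●ₘ 𝟙 A)) := by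
      simp only [circ_comp, bull_id, Category.id_comp, Category.comp_id]
    simp only [Category.assoc]
    rw [reassoc_of% h1, reassoc_of% zeta_natural]
    simp only [bull_comp, Category.id_comp, Category.comp_id, circ_id, h]

/-- The first one of the two morphisms `(P ∘ D) ∘ B ⟶ P ∘ B` whose coequalizer is the relative
product `P ∘_D B`, for a right `D`-module `P`: it uses the action on `P`. -/
abbrev relLeft {D : C} [CircMon D] (B : C) (P : RightMod D) : (P.A ⊚ D) ⊚ B ⟶ P.A ⊚ B :=
  P.a ⊚ₘ 𝟙 B

/-- The second one of the two morphisms `(P ∘ D) ∘ B ⟶ P ∘ B` whose coequalizer is the relative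
product `P ∘_D B`: it uses the left action of `D` on `B` induced by `ω : D ⟶ B`. -/
abbrev relRight {D : C} [CircMon D] (ω : D ⟶ B) (P : RightMod D) : (P.A ⊚ D) ⊚ B ⟶ P.A ⊚ B :=
  (aC P.A D B).hom ≫ (𝟙 P.A ⊚ₘ ((ω ⊚ₘ 𝟙 B) ≫ mulC B))

/-- Powers of the functor `(-) ∘ B`. -/
def circPow (B : C) : ℕ → C ⥤ C
  | 0 => 𝟭 C
  | n + 1 => circPow B n ⋙ circRight B

/-- `β⁰_Q` coequalizes the pair of morphisms which defines `(Q • I) ∘_D B`. -/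
theorem beta0_coequalizes {R : ComoduleMonoid A B} {D : C} [CircMon D]
    {S : ComoduleMonoid (unitI C) D} (P : CoinvariantPart R S) {ω : D ⟶ B}
    (hω : IsCircMonHom ω) (h : ω = P.omega) (Q : RightMod B) :
    relLeft B (bullMod S (restrictMod ω hω Q)) ≫ (beta0 R).app Q =
      relRight ω (bullMod S (restrictMod ω hω Q)) ≫ (beta0 R).app Q := by
  -- `ι` recovered from the coaction of `D` and `ω`
  have hι : S.coact ≫ (P.ι ●ₘ 𝟙 (unitI C)) =
      P.ι ≫ (𝟙 B ●ₘ comulB (unitI C)) ≫ (aB B (unitI C) (unitI C)).inv := P.colinear.symm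
  have hb : S.coact ≫ (ω ●ₘ 𝟙 (unitI C)) = P.ι := by
    have e : ω ●ₘ 𝟙 (unitI C) = (P.ι ●ₘ 𝟙 (unitI C)) ≫
        ((𝟙 B ●ₘ tau C) ●ₘ 𝟙 (unitI C)) ≫ ((rB B).hom ●ₘ 𝟙 (unitI C)) := by
      rw [h, bull_comp, bull_comp, Category.comp_id, Category.comp_id]
    rw [e, reassoc_of% hι, ← reassoc_of% aB_inv_nat, ← triangleB, Iso.inv_hom_id_assoc,
      bull_comp, bull_comp]
    simp only [Category.comp_id, counit_comulB, bull_id]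
  -- the coaction of `B` along `ω`
  have hc : ω ≫ R.coact = P.ι ≫ (𝟙 B ●ₘ oneC A) := by
    have w : P.ι ≫ (R.coact ●ₘ 𝟙 (unitI C)) = P.ι ≫ (𝟙 B ●ₘ comulB (unitI C)) ≫
        (aB B (unitI C) (unitI C)).inv ≫ ((𝟙 B ●ₘ oneC A) ●ₘ 𝟙 (unitI C)) :=
      congrArg Comonad.Coalgebra.Hom.f P.condition
    have e1 : (𝟙 B ●ₘ tau C) ≫ (R.coact ●ₘ 𝟙 (unitJ C)) =
        (R.coact ●ₘ 𝟙 (unitI C)) ≫ ((𝟙 B ●ₘ 𝟙 A) ●ₘ tau C) := by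
      simp only [bull_comp, bull_id, Category.id_comp, Category.comp_id]
    have e2 : ((𝟙 B ●ₘ oneC A) ●ₘ 𝟙 (unitI C)) ≫ ((𝟙 B ●ₘ 𝟙 A) ●ₘ tau C) =
        ((𝟙 B ●ₘ 𝟙 (unitI C)) ●ₘ tau C) ≫ ((𝟙 B ●ₘ oneC A) ●ₘ 𝟙 (unitJ C)) := by
      simp only [bull_comp, Category.id_comp, Category.comp_id]
    rw [h, Category.assoc, Category.assoc, ← rB_nat, reassoc_of% e1, reassoc_of% w,
      reassoc_of% e2, ← reassoc_of% aB_inv_nat, rB_nat, ← rB_tensor, Category.assoc,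
      Iso.inv_hom_id_assoc, bull_comp_assoc, bull_comp_assoc, Category.comp_id,
      Category.assoc, comul_counitB, Category.comp_id, bull_id, Category.id_comp]
  -- the action of `D` on `Q • I`
  have hl : (𝟙 (Q.A ● unitI C) ⊚ₘ S.coact) ≫ zeta Q.A (unitI C) D (unitI C) ≫
      (((𝟙 Q.A ⊚ₘ ω) ≫ Q.a) ●ₘ mulC (unitI C)) =
      (𝟙 (Q.A ● unitI C) ⊚ₘ P.ι) ≫ zeta Q.A (unitI C) B (unitI C) ≫
        (Q.a ●ₘ mulC (unitI C)) := by
    have e : ((𝟙 Q.A ⊚ₘ ω) ≫ Q.a) ●ₘ mulC (unitI C) =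
        ((𝟙 Q.A ⊚ₘ ω) ●ₘ (𝟙 (unitI C) ⊚ₘ 𝟙 (unitI C))) ≫ (Q.a ●ₘ mulC (unitI C)) := by
      rw [circ_id, bull_comp, Category.id_comp]
    rw [e, ← reassoc_of% zeta_natural, circ_comp_assoc, bull_id, Category.comp_id, hb]
  have ha : (Q.a ⊚ₘ 𝟙 B) ≫ Q.a = (aC Q.A B B).hom ≫ (𝟙 Q.A ⊚ₘ mulC B) ≫ Q.a := mod_assoc Q
  -- left hand side
  have hL : (((𝟙 (Q.A ● unitI C) ⊚ₘ S.coact) ≫ zeta Q.A (unitI C) D (unitI C) ≫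
      (((𝟙 Q.A ⊚ₘ ω) ≫ Q.a) ●ₘ mulC (unitI C))) ⊚ₘ 𝟙 B) ≫
        (𝟙 (Q.A ● unitI C) ⊚ₘ R.coact) =
      ((𝟙 (Q.A ● unitI C) ⊚ₘ P.ι) ⊚ₘ R.coact) ≫
        (zeta Q.A (unitI C) B (unitI C) ⊚ₘ 𝟙 (B ● A)) ≫
          ((Q.a ●ₘ mulC (unitI C)) ⊚ₘ (𝟙 B ●ₘ 𝟙 A)) := by
    rw [hl]
    simp only [circ_comp, bull_id, Category.id_comp, Category.comp_id]
  -- right hand side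
  have hR : (𝟙 (Q.A ● unitI C) ⊚ₘ ((ω ⊚ₘ 𝟙 B) ≫ mulC B)) ≫
        (𝟙 (Q.A ● unitI C) ⊚ₘ R.coact) =
      (𝟙 (Q.A ● unitI C) ⊚ₘ (P.ι ⊚ₘ R.coact)) ≫
        (𝟙 (Q.A ● unitI C) ⊚ₘ zeta B (unitI C) B A) ≫
          ((𝟙 Q.A ●ₘ 𝟙 (unitI C)) ⊚ₘ (mulC B ●ₘ ((oneC A ⊚ₘ 𝟙 A) ≫ mulC A))) := by
    have e : ((ω ⊚ₘ 𝟙 B) ≫ mulC B) ≫ R.coact = (P.ι ⊚ₘ R.coact) ≫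
        zeta B (unitI C) B A ≫ (mulC B ●ₘ ((oneC A ⊚ₘ 𝟙 A) ≫ mulC A)) := by
      have e' : (P.ι ≫ (𝟙 B ●ₘ oneC A)) ⊚ₘ R.coact =
          (P.ι ⊚ₘ R.coact) ≫ ((𝟙 B ●ₘ oneC A) ⊚ₘ (𝟙 B ●ₘ 𝟙 A)) := by
        rw [circ_comp, bull_id, Category.comp_id]
      rw [Category.assoc, R.mul_coact, circ_comp_assoc, hc, Category.id_comp, e',
        Category.assoc, reassoc_of% zeta_natural, bull_comp, circ_id, Category.id_comp]
    rw [circ_comp, e, bull_id]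
    simp only [circ_comp, Category.comp_id]
  change (((𝟙 (Q.A ● unitI C) ⊚ₘ S.coact) ≫ zeta Q.A (unitI C) D (unitI C) ≫
      (((𝟙 Q.A ⊚ₘ ω) ≫ Q.a) ●ₘ mulC (unitI C))) ⊚ₘ 𝟙 B) ≫
        (𝟙 (Q.A ● unitI C) ⊚ₘ R.coact) ≫ zeta Q.A (unitI C) B A ≫
          (𝟙 (Q.A ⊚ B) ●ₘ (lC A).hom) ≫ (Q.a ●ₘ 𝟙 A) =
    ((aC (Q.A ● unitI C) D B).hom ≫ (𝟙 (Q.A ● unitI C) ⊚ₘ ((ω ⊚ₘ 𝟙 B) ≫ mulC B))) ≫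
        (𝟙 (Q.A ● unitI C) ⊚ₘ R.coact) ≫ zeta Q.A (unitI C) B A ≫
          (𝟙 (Q.A ⊚ B) ●ₘ (lC A).hom) ≫ (Q.a ●ₘ 𝟙 A)
  have hm : ((lC (unitI C)).hom ⊚ₘ 𝟙 A) ≫ (lC A).hom =
      (aC (unitI C) (unitI C) A).hom ≫ (𝟙 (unitI C) ⊚ₘ (lC A).hom) ≫ (lC A).hom := by
    rw [← lC_tensor, Category.assoc, lC_nat]
  rw [reassoc_of% hL, Category.assoc, reassoc_of% hR, reassoc_of% zeta_natural,
    reassoc_of% zeta_natural, one_mulC, mulC_unitI]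
  simp only [bull_comp, Category.id_comp, Category.comp_id]
  rw [ha, hm, ← bull_comp (aC _ _ _).hom (aC _ _ _).hom, reassoc_of% zeta_assoc_circ,
    reassoc_of% aC_nat]

/-- The natural transformation `β_Q : (Q • I) ∘_D B ⟶ Q • A` attached to the coinvariant part
`ω : D ⟶ B` of `B`: the unique morphism whose composite with the projection
`(Q • I) ∘ B ⟶ (Q • I) ∘_D B` is `β⁰_Q`. -/
noncomputable abbrev beta {R : ComoduleMonoid A B} {D : C} [CircMon D]
    {S : ComoduleMonoid (unitI C) D} (P : CoinvariantPart R S) {ω : D ⟶ B}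
    (hω : IsCircMonHom ω) (h : ω = P.omega)
    (hc : ∀ M : RightMod D, HasCoequalizer (relLeft B M) (relRight ω M)) (Q : RightMod B) :
    haveI := hc (bullMod S (restrictMod ω hω Q))
    coequalizer (relLeft B (bullMod S (restrictMod ω hω Q)))
      (relRight ω (bullMod S (restrictMod ω hω Q))) ⟶ Q.A ● A :=
  haveI := hc (bullMod S (restrictMod ω hω Q))
  coequalizer.desc ((beta0 R).app Q) (beta0_coequalizes P hω h Q)

/-- A monoid morphism `ω : D ⟶ B` is a Galois extension by the bimonoid `A`, where `B` is a
comodule monoid over `A` through `R`: the coinvariant part of every relative Hopf module exists,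
`ω` is the coinvariant part of `B`, the relative products `M ∘_D B` exist and are preserved by all
powers of `(-) ∘ B`, and `β` is an isomorphism. -/
def IsGaloisExtension (R : ComoduleMonoid A B) {D : C} [CircMon D] (ω : D ⟶ B) : Prop :=
  ∃ hω : IsCircMonHom ω,
    (∀ X : HopfModule R, HasEqualizer (phi0 X) (phi1 X)) ∧
    ∃ (S : ComoduleMonoid (unitI C) D) (P : CoinvariantPart R S) (h : ω = P.omega)
      (hc : ∀ M : RightMod D, HasCoequalizer (relLeft B M) (relRight ω M)),
      (∀ (M : RightMod D) (n : ℕ),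
        PreservesColimit (parallelPair (relLeft B M) (relRight ω M)) (circPow B n)) ∧
      ∀ Q : RightMod B, IsIso (beta P hω h hc Q)

/-- The functor `H : M^I ⥤ M ⥤ M_J`, the forgetful functor followed by `(-) ∘ J`. -/
abbrev functorH (C : Type u) [Category.{v} C] [DuoidalCategory C] :
    RightComod (unitI C) ⥤ RightMod (unitJ C) :=
  (bullComonad (unitI C)).forget ⋙ (circMonad (unitJ C)).free

end Coinvariants

end DuoidalCategory

/-! Write `V` for the functor forgetting the coaction of relative Hopf modules. The compatibility
axiom says that the coaction is `B`-linear into the lifted comonad `(-) • A` on `B`-modules, so `V`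
has the cofree right adjoint `G = (-) • A`. The composite `V K` is the free module functor on
`I`-comodules (`ind`). It is a composite of two left adjoints, hence has a right adjoint `R = (-) •
I` (`coind`). The canonical map `β : K R ⟶ G` is the mate comparing the two adjunctions
(`betaHopf_counit`). Everything after this identification is formal and is carried out for
`ComparisonData`.

Composing with `β_Q` gives a bijection from morphisms `Z ⟶ R Q` to morphisms `K Z ⟶ G Q`. If `K` is
an equivalence, Yoneda makes `β` invertible (`isIso_β_of_isEquivalence`).

Conversely, if `β` is invertible, the comonad `V G` is that of `V K ⊣ R`, and `K` is its comparison
functor. Such a functor is an equivalence as soon as the unit of the adjunction has a natural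
retraction and idempotents split: each coinvariant part is the splitting of an explicit idempotent
(`isEquivalence_of_retraction`). For `B = A` the retraction comes from the counit `ε : A ⟶ J`. It
carries the unit of the adjunction for `A` to the one for `J`, and the latter is invertible because
its left adjoint is the fully faithful functor `H`.

For the Galois condition, morphisms from `Z` that equalize `φ⁰` and `φ¹` are exactly the transposes
of Hopf module morphisms `K Z ⟶ X` (`condition`, `exists_of_condition`). The coinvariant part
therefore represents `Hom(K -, X)`. It exists when `K` is an equivalence, and it is `I` for `X = A`
since `I ∘ A ≅ A`. Over `D = I` the two maps defining the relative product coincide, so `β` is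
invertible in the Galois sense exactly when the transformation in (ii) is. -/

namespace DuoidalCategory

variable {C : Type u} [Category.{v} C] [DuoidalCategory C]

/-! ### The adjunction between `I`-comodules and `B`-modules. -/

/-- The functor `M^I ⥤ M_B` sending an `I`-comodule to the free `B`-module on it. -/
abbrev ind (B : C) [CircMon B] : RightComod (unitI C) ⥤ RightMod B :=
  (bullComonad (unitI C)).forget ⋙ (circMonad B).free

/-- The functor `M_B ⥤ M^I` sending a `B`-module to the cofree `I`-comodule on it. -/
abbrev coind (B : C) [CircMon B] : RightMod B ⥤ RightComod (unitI C) :=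
  (circMonad B).forget ⋙ (bullComonad (unitI C)).cofree

/-- The functor `ind B` is left adjoint to `coind B`. -/
abbrev indAdj (B : C) [CircMon B] : ind B ⊣ coind B :=
  (bullComonad (unitI C)).adj.comp (circMonad B).adj

/-- Composite adjunctions carry identity factors from their general construction. This explicit
form, and the one for the counit, is what can be compared with formulas in `ζ`. -/
theorem indAdj_unit_f (B : C) [CircMon B] (Z : RightComod (unitI C)) :
    ((indAdj B).unit.app Z).f =
      Z.a ≫ (((rC Z.A).inv ≫ (𝟙 Z.A ⊚ₘ oneC B)) ●ₘ 𝟙 (unitI C)) := by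
  have h1 : ((bullComonad (unitI C)).adj.unit.app Z).f = Z.a := by
    change Z.a ≫ (𝟙 Z.A ●ₘ 𝟙 (unitI C)) = Z.a
    rw [bull_id, Category.comp_id]
  have h2 : (circMonad B).adj.unit.app Z.A = (rC Z.A).inv ≫ (𝟙 Z.A ⊚ₘ oneC B) := by
    change ((rC Z.A).inv ≫ (𝟙 Z.A ⊚ₘ oneC B)) ≫ 𝟙 (Z.A ⊚ B) = _
    rw [Category.comp_id]
  rw [Adjunction.comp_unit_app]
  exact congrArg₂ (fun (s : Z.A ⟶ Z.A ● unitI C) (t : Z.A ⟶ Z.A ⊚ B) =>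
    s ≫ (t ●ₘ 𝟙 (unitI C))) h1 h2

theorem indAdj_counit_f (B : C) [CircMon B] (Q : RightMod B) :
    ((indAdj B).counit.app Q).f =
      (((𝟙 Q.A ●ₘ tau C) ≫ (rB Q.A).hom) ⊚ₘ 𝟙 B) ≫ Q.a := by
  have h1 : (bullComonad (unitI C)).adj.counit.app Q.A =
      (𝟙 Q.A ●ₘ tau C) ≫ (rB Q.A).hom := by
    change 𝟙 (Q.A ● unitI C) ≫ (𝟙 Q.A ●ₘ tau C) ≫ (rB Q.A).hom = _
    rw [Category.id_comp]
  have h2 : ((circMonad B).adj.counit.app Q).f = Q.a := by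
    change (𝟙 Q.A ⊚ₘ 𝟙 B) ≫ Q.a = Q.a
    rw [circ_id, Category.id_comp]
  rw [Adjunction.comp_counit_app]
  exact congrArg₂ (fun (s : Q.A ● unitI C ⟶ Q.A) (t : Q.A ⊚ B ⟶ Q.A) =>
    (s ⊚ₘ 𝟙 B) ≫ t) h1 h2

/-! ### Cofree relative Hopf modules and the canonical map as a mate. -/

section

variable {A B : C} [CircMon A] [BullComon A] [IsBimonoid A] [CircMon B]

omit [IsBimonoid A] in
/-- The interchange law followed by two actions, when the coactions are comultiplied. -/
theorem zeta_coassoc (R : ComoduleMonoid A B) (E : C) [BullComon E] (Q : RightMod B)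
    (m : E ⊚ A ⟶ A) (hm : m ≫ comulB A = (comulB E ⊚ₘ comulB A) ≫ zeta E E A A ≫ (m ●ₘ m)) :
    ((𝟙 (Q.A ● E) ⊚ₘ R.coact) ≫ zeta Q.A E B A ≫ (Q.a ●ₘ m)) ≫
        (𝟙 Q.A ●ₘ comulB A) ≫ (aB Q.A A A).inv =
      (((𝟙 Q.A ●ₘ comulB E) ≫ (aB Q.A E E).inv) ⊚ₘ R.coact) ≫ zeta (Q.A ● E) E B A ≫
        (((𝟙 (Q.A ● E) ⊚ₘ R.coact) ≫ zeta Q.A E B A ≫ (Q.a ●ₘ m)) ●ₘ m) := by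
  have hz : zeta (Q.A ● E) E (B ● A) A ≫ (zeta Q.A E B A ●ₘ 𝟙 (E ⊚ A)) =
      ((aB Q.A E E).hom ⊚ₘ (aB B A A).hom) ≫ zeta Q.A (E ● E) B (A ● A) ≫
        (𝟙 (Q.A ⊚ B) ●ₘ zeta E E A A) ≫ (aB (Q.A ⊚ B) (E ⊚ A) (E ⊚ A)).inv := by
    rw [← cancel_mono (aB (Q.A ⊚ B) (E ⊚ A) (E ⊚ A)).hom]
    simp only [Category.assoc, Iso.inv_hom_id, Category.comp_id]
    exact zeta_assoc_bull _ _ _ _ _ _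
  have e1 : ((𝟙 (Q.A ● E) ⊚ₘ R.coact) ≫ zeta Q.A E B A ≫ (Q.a ●ₘ m)) ●ₘ m =
      ((𝟙 (Q.A ● E) ⊚ₘ R.coact) ●ₘ (𝟙 E ⊚ₘ 𝟙 A)) ≫ (zeta Q.A E B A ●ₘ 𝟙 (E ⊚ A)) ≫
        ((Q.a ●ₘ m) ●ₘ m) := by
    simp only [bull_comp, circ_id, Category.id_comp]
  have e2 : (((𝟙 Q.A ●ₘ comulB E) ≫ (aB Q.A E E).inv) ⊚ₘ R.coact) ≫
      ((𝟙 (Q.A ● E) ●ₘ 𝟙 E) ⊚ₘ (R.coact ●ₘ 𝟙 A)) ≫ ((aB Q.A E E).hom ⊚ₘ (aB B A A).hom) =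
      (𝟙 (Q.A ● E) ⊚ₘ R.coact) ≫ ((𝟙 Q.A ●ₘ comulB E) ⊚ₘ (𝟙 B ●ₘ comulB A)) := by
    simp only [circ_comp, bull_id, Category.comp_id, Category.assoc, Iso.inv_hom_id,
      Category.id_comp, R.coassoc]
  have e3 : (Q.a ●ₘ m) ≫ (𝟙 Q.A ●ₘ comulB A) =
      ((𝟙 Q.A ⊚ₘ 𝟙 B) ●ₘ (comulB E ⊚ₘ comulB A)) ≫ (𝟙 (Q.A ⊚ B) ●ₘ zeta E E A A) ≫
        (Q.a ●ₘ (m ●ₘ m)) := by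
    simp only [bull_comp, circ_id, Category.id_comp, Category.comp_id, hm]
  simp only [Category.assoc]
  rw [e1, ← reassoc_of% zeta_natural, reassoc_of% hz, reassoc_of% e2, reassoc_of% e3,
    ← reassoc_of% zeta_natural, ← aB_inv_nat]

/-- With `lC_counit`, this verifies the hypotheses of `zeta_coassoc` and `zeta_counit` for `E = I`
acting on `A` by the unit constraint. For `E = A` those hypotheses are bimonoid axioms. One
computation thus serves both the cofree Hopf module and the canonical map. -/
theorem lC_comul (A : C) [BullComon A] : (lC A).hom ≫ comulB A =
    (comulB (unitI C) ⊚ₘ comulB A) ≫ zeta (unitI C) (unitI C) A A ≫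
      ((lC A).hom ●ₘ (lC A).hom) := by
  rw [← lC_nat, ← left_unit_circ, circ_comp_assoc, Category.id_comp, Category.comp_id]

theorem lC_counit (A : C) [BullComon A] :
    (lC A).hom ≫ counitB A = (counitB (unitI C) ⊚ₘ counitB A) ≫ mulC (unitJ C) := by
  rw [← lC_nat, ← one_mulC, circ_comp_assoc, Category.id_comp, Category.comp_id, one_eq_counit]

theorem lC_mul (A : C) [CircMon A] : ((lC A).hom ⊚ₘ 𝟙 A) ≫ mulC A =
    (aC (unitI C) A A).hom ≫ (𝟙 (unitI C) ⊚ₘ mulC A) ≫ (lC A).hom := by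
  rw [lC_nat, ← lC_tensor, Category.assoc]

omit [IsBimonoid A] in
/-- The interchange law followed by two actions, when the counits are applied. -/
theorem zeta_counit (R : ComoduleMonoid A B) (E : C) [BullComon E] (Q : RightMod B)
    (m : E ⊚ A ⟶ A) (hm : m ≫ counitB A = (counitB E ⊚ₘ counitB A) ≫ mulC (unitJ C)) :
    ((𝟙 (Q.A ● E) ⊚ₘ R.coact) ≫ zeta Q.A E B A ≫ (Q.a ●ₘ m)) ≫
        (𝟙 Q.A ●ₘ counitB A) ≫ (rB Q.A).hom =
      (((𝟙 Q.A ●ₘ counitB E) ≫ (rB Q.A).hom) ⊚ₘ 𝟙 B) ≫ Q.a := by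
  have e1 : (Q.a ●ₘ m) ≫ (𝟙 Q.A ●ₘ counitB A) =
      ((𝟙 Q.A ⊚ₘ 𝟙 B) ●ₘ (counitB E ⊚ₘ counitB A)) ≫ (𝟙 (Q.A ⊚ B) ●ₘ mulC (unitJ C)) ≫
        (Q.a ●ₘ 𝟙 (unitJ C)) := by
    simp only [bull_comp, circ_id, Category.id_comp, Category.comp_id, hm]
  simp only [Category.assoc]
  rw [reassoc_of% e1, ← reassoc_of% zeta_natural, rB_nat, reassoc_of% right_unit_bull]
  simp only [circ_comp_assoc, Category.id_comp, R.counit]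

/-- The cofree relative Hopf module `Q • A` on a `B`-module `Q`. -/
abbrev cofreeHopf (R : ComoduleMonoid A B) (Q : RightMod B) : HopfModule R where
  mod := bullMod R Q
  coact := (𝟙 Q.A ●ₘ comulB A) ≫ (aB Q.A A A).inv
  counit := (bullComonad A).left_counit Q.A
  coassoc := by
    have h := (bullComonad A).coassoc Q.A
    dsimp only at h ⊢
    rw [← Category.assoc _ (_ ●ₘ _) (aB _ _ _).hom, h]
    simp only [Category.assoc, Iso.inv_hom_id, Category.comp_id]
  compat := by
    change ((𝟙 (Q.A ● A) ⊚ₘ R.coact) ≫ zeta Q.A A B A ≫ (Q.a ●ₘ mulC A)) ≫ _ = _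
    rw [zeta_coassoc R A Q (mulC A) IsBimonoid.mul_comul]

/-- The coaction of a relative Hopf module `X`, as a morphism to the cofree one. -/
abbrev HopfModule.toCofree {R : ComoduleMonoid A B} (X : HopfModule R) :
    X ⟶ cofreeHopf R X.mod :=
  HopfModule.Hom.mk X.coact
    (by
      change X.mod.a ≫ X.coact = (X.coact ⊚ₘ 𝟙 B) ≫ (𝟙 (X.mod.A ● A) ⊚ₘ R.coact) ≫
        zeta X.mod.A A B A ≫ (X.mod.a ●ₘ mulC A)
      rw [X.compat, circ_comp_assoc, Category.id_comp, Category.comp_id])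
    (by
      change X.coact ≫ (𝟙 X.mod.A ●ₘ comulB A) ≫ (aB X.mod.A A A).inv = _
      rw [← Category.assoc, X.coassoc]
      simp only [Category.assoc, Iso.hom_inv_id, Category.comp_id])

/-- The functor forgetting the coaction of a relative Hopf module. -/
abbrev HopfModule.forget (R : ComoduleMonoid A B) : HopfModule R ⥤ RightMod B where
  obj X := X.mod
  map f := { f := f.f, h := f.act_comp.symm }

/-- The counit `Q • A ⟶ Q` as a morphism of `B`-modules. -/
abbrev cofreeCounit (R : ComoduleMonoid A B) (Q : RightMod B) : (cofreeHopf R Q).mod ⟶ Q where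
  f := (𝟙 Q.A ●ₘ counitB A) ≫ (rB Q.A).hom
  h := (zeta_counit R A Q (mulC A) IsBimonoid.mul_counit).symm

/-- A morphism to a cofree relative Hopf module is determined by its composite with the
counit. -/
theorem cofreeHopf_hom_f {R : ComoduleMonoid A B} {X : HopfModule R} {Q : RightMod B}
    (f : X ⟶ cofreeHopf R Q) : f.f = X.coact ≫
      (((HopfModule.forget R).map f ≫ cofreeCounit R Q).f ●ₘ 𝟙 A) := by
  have e : (((HopfModule.forget R).map f ≫ cofreeCounit R Q).f ●ₘ 𝟙 A) =
      (f.f ●ₘ 𝟙 A) ≫ (((𝟙 Q.A ●ₘ counitB A) ≫ (rB Q.A).hom) ●ₘ 𝟙 A) := by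
    rw [bull_comp, Category.comp_id]; rfl
  rw [e, ← Category.assoc, ← f.comp_coact, Category.assoc]
  exact (Category.comp_id _).symm.trans
    (congrArg (f.f ≫ ·) ((bullComonad A).right_counit Q.A).symm)

omit [IsBimonoid A] in
theorem beta0_app_eq (R : ComoduleMonoid A B) (Q : RightMod B) :
    (beta0 R).app Q =
      (𝟙 (Q.A ● unitI C) ⊚ₘ R.coact) ≫ zeta Q.A (unitI C) B A ≫ (Q.a ●ₘ (lC A).hom) := by
  change (𝟙 (Q.A ● unitI C) ⊚ₘ R.coact) ≫ zeta Q.A (unitI C) B A ≫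
    (𝟙 (Q.A ⊚ B) ●ₘ (lC A).hom) ≫ (Q.a ●ₘ 𝟙 A) = _
  rw [bull_comp, Category.id_comp, Category.comp_id]

/-- The canonical map `β_Q` as a morphism of relative Hopf modules. -/
abbrev betaHopf (R : ComoduleMonoid A B) (Q : RightMod B) :
    (comparison R).obj ((coind B).obj Q) ⟶ cofreeHopf R Q :=
  HopfModule.Hom.mk ((beta0 R).app Q)
    (by
      rw [beta0_app_eq]
      have e1 : (((𝟙 (Q.A ● unitI C) ⊚ₘ R.coact) ≫ zeta Q.A (unitI C) B A ≫
            (Q.a ●ₘ (lC A).hom)) ⊚ₘ 𝟙 B) ≫ (𝟙 (Q.A ● A) ⊚ₘ R.coact) =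
          ((𝟙 (Q.A ● unitI C) ⊚ₘ R.coact) ⊚ₘ R.coact) ≫
            (zeta Q.A (unitI C) B A ⊚ₘ 𝟙 (B ● A)) ≫
              ((Q.a ●ₘ (lC A).hom) ⊚ₘ (𝟙 B ●ₘ 𝟙 A)) := by
        simp only [circ_comp, bull_id, Category.comp_id, Category.id_comp]
      have e2 : (𝟙 (Q.A ● unitI C) ⊚ₘ mulC B) ≫ (𝟙 (Q.A ● unitI C) ⊚ₘ R.coact) =
          (𝟙 (Q.A ● unitI C) ⊚ₘ (R.coact ⊚ₘ R.coact)) ≫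
            (𝟙 (Q.A ● unitI C) ⊚ₘ zeta B A B A) ≫
              ((𝟙 Q.A ●ₘ 𝟙 (unitI C)) ⊚ₘ (mulC B ●ₘ mulC A)) := by
        simp only [circ_comp, bull_id, Category.comp_id, R.mul_coact]
      change ((aC (Q.A ● unitI C) B B).hom ≫ (𝟙 (Q.A ● unitI C) ⊚ₘ mulC B)) ≫
          (𝟙 (Q.A ● unitI C) ⊚ₘ R.coact) ≫ zeta Q.A (unitI C) B A ≫ (Q.a ●ₘ (lC A).hom) =
        (((𝟙 (Q.A ● unitI C) ⊚ₘ R.coact) ≫ zeta Q.A (unitI C) B A ≫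
            (Q.a ●ₘ (lC A).hom)) ⊚ₘ 𝟙 B) ≫ (𝟙 (Q.A ● A) ⊚ₘ R.coact) ≫
          zeta Q.A A B A ≫ (Q.a ●ₘ mulC A)
      rw [reassoc_of% e1, Category.assoc, reassoc_of% e2, reassoc_of% zeta_natural,
        reassoc_of% zeta_natural, bull_comp, bull_comp, lC_mul, mod_assoc,
        ← bull_comp (aC _ _ _).hom (aC _ _ _).hom, reassoc_of% zeta_assoc_circ,
        reassoc_of% aC_nat])
    (by
      rw [beta0_app_eq]
      have h := zeta_coassoc R (unitI C) Q (lC A).hom (lC_comul A)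
      refine h.trans ?_
      change _ = ((((𝟙 Q.A ●ₘ comulB (unitI C)) ≫ (aB _ _ _).inv) ⊚ₘ R.coact) ≫
        zeta (Q.A ● unitI C) (unitI C) B A ≫ (𝟙 ((Q.A ● unitI C) ⊚ B) ●ₘ (lC A).hom)) ≫
          (((𝟙 (Q.A ● unitI C) ⊚ₘ R.coact) ≫ zeta Q.A (unitI C) B A ≫
            (Q.a ●ₘ (lC A).hom)) ●ₘ 𝟙 A)
      simp only [Category.assoc, bull_comp, Category.id_comp, Category.comp_id])

/-- This characterizes `β_Q` as the mate: its transpose along the cofree adjunction is the counit of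
`indAdj B`. It is the only property of `β` that the formal argument needs. -/
theorem betaHopf_counit (R : ComoduleMonoid A B) (Q : RightMod B) :
    (HopfModule.forget R).map (betaHopf R Q) ≫ cofreeCounit R Q = (indAdj B).counit.app Q := by
  apply Monad.Algebra.Hom.ext
  rw [indAdj_counit_f]
  change (beta0 R).app Q ≫ (𝟙 Q.A ●ₘ counitB A) ≫ (rB Q.A).hom = _
  rw [beta0_app_eq]
  exact zeta_counit R (unitI C) Q (lC A).hom (lC_counit A)

end

/-! ### Splitting of idempotents in categories of coalgebras. -/

/-- Coalgebras over a comonad on an idempotent complete category form an idempotent complete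
category. -/
theorem coalgebra_isIdempotentComplete {D : Type u} [Category.{v} D] [IsIdempotentComplete D]
    (G : Comonad D) : IsIdempotentComplete G.Coalgebra where
  idempotents_split X p hp := by
    have hp' : p.f ≫ p.f = p.f := congrArg Comonad.Coalgebra.Hom.f hp
    obtain ⟨Y, i, e, hie, hei⟩ := IsIdempotentComplete.idempotents_split X.A p.f hp'
    have hip : i ≫ p.f = i := by rw [← hei, reassoc_of% hie]
    have hpe : p.f ≫ e = e := by rw [← hei, Category.assoc, hie, Category.comp_id]
    have hp1 : X.a ≫ G.map p.f = p.f ≫ X.a := p.h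
    have hε : G.map e ≫ G.ε.app Y = G.ε.app X.A ≫ e := G.ε.naturality e
    have hδ : G.map e ≫ G.δ.app Y = G.δ.app X.A ≫ G.map (G.map e) := G.δ.naturality e
    -- This is the only coaction on the image for which both `i` and `e` can be morphisms of
    -- coalgebras.
    let Z : G.Coalgebra :=
      { A := Y
        a := i ≫ X.a ≫ G.map e
        counit := by
          rw [Category.assoc, Category.assoc, hε, X.counit_assoc, hie]
        coassoc := by
          have h1 : G.map e ≫ G.map (i ≫ X.a ≫ G.map e) =
              G.map p.f ≫ G.map X.a ≫ G.map (G.map e) := by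
            rw [← G.map_comp, reassoc_of% hei, G.map_comp, G.map_comp]
          simp only [Category.assoc]
          rw [hδ, h1, reassoc_of% hp1, reassoc_of% hip, X.coassoc_assoc] }
    refine ⟨Z, ⟨i, ?_⟩, ⟨e, ?_⟩, Comonad.Coalgebra.Hom.ext hie, Comonad.Coalgebra.Hom.ext hei⟩
    · change (i ≫ X.a ≫ G.map e) ≫ G.map i = i ≫ X.a
      rw [Category.assoc, Category.assoc, ← G.map_comp, hei, hp1, reassoc_of% hip]
    · change X.a ≫ G.map e = e ≫ i ≫ X.a ≫ G.map e
      rw [reassoc_of% hei, ← reassoc_of% hp1, ← G.map_comp, hpe]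

/-! ### The formal comparison theorem. -/

/-- A functor `V : H ⥤ D` with a right adjoint `G`, a functor `K : E ⥤ H` whose composite with `V`
has a right adjoint `R`, and the mate `β : R ⋙ K ⟶ G` of these adjunctions. It is required that
morphisms of `H` can be detected in `D` by means of the unit of `V ⊣ G`. -/
structure ComparisonData (E : Type*) [Category* E] (D : Type*) [Category* D] (H : Type*)
    [Category* H] where
  K : E ⥤ H
  V : H ⥤ D
  R : D ⥤ E
  G : D ⥤ H
  adjR : K ⋙ V ⊣ R
  adjG : V ⊣ G
  faithful : V.Faithful
  lift : ∀ {X Y : H} (t : V.obj X ⟶ V.obj Y) (k : X ⟶ G.obj (V.obj Y)),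
    t ≫ V.map (adjG.unit.app Y) = V.map k → ∃ g : X ⟶ Y, V.map g = t
  β : ∀ Q, K.obj (R.obj Q) ⟶ G.obj Q
  β_counit : ∀ Q, V.map (β Q) ≫ adjG.counit.app Q = adjR.counit.app Q

namespace ComparisonData

variable {E : Type*} [Category* E] {D : Type*} [Category* D] {H : Type*} [Category* H]
  (S : ComparisonData E D H)

/-- The transposition of morphisms along `K ⋙ V ⊣ R`. -/
def tr {Z : E} {Q : D} : (S.V.obj (S.K.obj Z) ⟶ Q) ≃ (Z ⟶ S.R.obj Q) := S.adjR.homEquiv Z Q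

/-- The unit of `K ⋙ V ⊣ R`. -/
def u (Z : E) : Z ⟶ S.R.obj (S.V.obj (S.K.obj Z)) := S.adjR.unit.app Z

/-- The counit of `K ⋙ V ⊣ R`. -/
def κ (Q : D) : S.V.obj (S.K.obj (S.R.obj Q)) ⟶ Q := S.adjR.counit.app Q

/-- The unit of `V ⊣ G`. -/
def ρ (X : H) : X ⟶ S.G.obj (S.V.obj X) := S.adjG.unit.app X

/-- The counit of `V ⊣ G`. -/
def ε (Q : D) : S.V.obj (S.G.obj Q) ⟶ Q := S.adjG.counit.app Q

theorem tr_apply {Z : E} {Q : D} (t : S.V.obj (S.K.obj Z) ⟶ Q) :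
    S.tr t = S.u Z ≫ S.R.map t :=
  S.adjR.homEquiv_unit Z Q t

theorem tr_symm_apply {Z : E} {Q : D} (c : Z ⟶ S.R.obj Q) :
    S.tr.symm c = S.V.map (S.K.map c) ≫ S.κ Q :=
  S.adjR.homEquiv_counit Z Q c

theorem tr_left {Z W : E} {Q : D} (m : W ⟶ Z) (t : S.V.obj (S.K.obj Z) ⟶ Q) :
    S.tr (S.V.map (S.K.map m) ≫ t) = m ≫ S.tr t :=
  S.adjR.homEquiv_naturality_left m t

theorem tr_right {Z : E} {Q Q' : D} (t : S.V.obj (S.K.obj Z) ⟶ Q) (f : Q ⟶ Q') :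
    S.tr (t ≫ f) = S.tr t ≫ S.R.map f :=
  S.adjR.homEquiv_naturality_right t f

theorem u_naturality {Z W : E} (m : W ⟶ Z) :
    S.u W ≫ S.R.map (S.V.map (S.K.map m)) = m ≫ S.u Z :=
  S.adjR.unit_naturality m

theorem κ_naturality {Q Q' : D} (f : Q ⟶ Q') :
    S.V.map (S.K.map (S.R.map f)) ≫ S.κ Q' = S.κ Q ≫ f :=
  S.adjR.counit_naturality f

theorem map_u_κ (Z : E) : S.V.map (S.K.map (S.u Z)) ≫ S.κ _ = 𝟙 _ :=
  S.adjR.left_triangle_components Z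

theorem map_ρ_ε (X : H) : S.V.map (S.ρ X) ≫ S.ε _ = 𝟙 _ :=
  S.adjG.left_triangle_components X

theorem map_β_ε (Q : D) : S.V.map (S.β Q) ≫ S.ε Q = S.κ Q :=
  S.β_counit Q

theorem G_ext {X : H} {Q : D} {f g : X ⟶ S.G.obj Q}
    (h : S.V.map f ≫ S.ε Q = S.V.map g ≫ S.ε Q) : f = g := by
  apply (S.adjG.homEquiv X Q).symm.injective
  rw [Adjunction.homEquiv_counit, Adjunction.homEquiv_counit]
  exact h

/-- A morphism from `K Z` to `G Q` factors through `β` by a transpose. -/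
theorem eq_map_comp_β {Z : E} {Q : D} (g : S.K.obj Z ⟶ S.G.obj Q) :
    g = S.K.map (S.tr (S.V.map g ≫ S.ε Q)) ≫ S.β Q := by
  apply S.G_ext
  rw [Functor.map_comp, Category.assoc, map_β_ε, ← tr_symm_apply, Equiv.symm_apply_apply]

/-- Both sides are transposed along `V ⊣ G`, where composition with `β` becomes the inverse of `tr`.
Together with `eq_map_comp_β` this makes `m ↦ K m ≫ β` bijective. -/
theorem map_comp_β_injective {Z : E} {Q : D} {m m' : Z ⟶ S.R.obj Q}
    (h : S.K.map m ≫ S.β Q = S.K.map m' ≫ S.β Q) : m = m' := by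
  apply S.tr.symm.injective
  rw [tr_symm_apply, tr_symm_apply, ← map_β_ε, ← Functor.map_comp_assoc, h,
    Functor.map_comp_assoc]

/-- Essential surjectivity turns the identity of `G Q` into a morphism out of some `K Z`, which
factors through `β` and yields a section. Fullness and injectivity of `m ↦ K m ≫ β` make the section
a two-sided inverse. -/
theorem isIso_β_of_isEquivalence [S.K.IsEquivalence] (Q : D) : IsIso (S.β Q) := by
  let θ := S.K.objObjPreimageIso (S.G.obj Q)
  let s := θ.inv ≫ S.K.map (S.tr (S.V.map θ.hom ≫ S.ε Q))
  have hs : s ≫ S.β Q = 𝟙 _ := by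
    rw [Category.assoc, ← eq_map_comp_β, Iso.inv_hom_id]
  refine ⟨s, ?_, hs⟩
  have hm : S.K.preimage (S.β Q ≫ s) = 𝟙 _ := by
    apply S.map_comp_β_injective
    rw [Functor.map_preimage, Category.assoc, hs, S.K.map_id, Category.comp_id,
      Category.id_comp]
  rw [← S.K.map_preimage (S.β Q ≫ s), hm, S.K.map_id]

/-- The first morphism whose equalizer is the coinvariant part of `X`. -/
def φ₀ (X : H) : S.R.obj (S.V.obj X) ⟶ S.R.obj (S.V.obj (S.G.obj (S.V.obj X))) :=
  S.R.map (S.V.map (S.ρ X))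

/-- The second morphism whose equalizer is the coinvariant part of `X`. -/
def φ₁ (X : H) : S.R.obj (S.V.obj X) ⟶ S.R.obj (S.V.obj (S.G.obj (S.V.obj X))) :=
  S.u _ ≫ S.R.map (S.V.map (S.β (S.V.obj X)))

/-- If `t` is the transpose of `c`, then `c ≫ φ₀` is the transpose of `t ≫ V ρ`. By this formula,
equalizing `φ₀` and `φ₁` means that `t ≫ V ρ` is the image under `V` of `K c ≫ β`. -/
theorem comp_φ₁ {Z : E} {X : H} (c : Z ⟶ S.R.obj (S.V.obj X)) :
    c ≫ S.φ₁ X = S.tr (S.V.map (S.K.map c ≫ S.β _)) := by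
  rw [φ₁, ← reassoc_of% S.u_naturality, ← Functor.map_comp, ← Functor.map_comp, tr_apply]

/-- The transpose of a morphism `K Z ⟶ X` of `H` equalizes `φ₀` and `φ₁`. -/
theorem condition {Z : E} {X : H} (g : S.K.obj Z ⟶ X) :
    S.tr (S.V.map g) ≫ S.φ₀ X = S.tr (S.V.map g) ≫ S.φ₁ X := by
  have h := S.eq_map_comp_β (g ≫ S.ρ X)
  rw [Functor.map_comp, Category.assoc, map_ρ_ε, Category.comp_id] at h
  rw [comp_φ₁, ← h, φ₀, ← tr_right, ← Functor.map_comp]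

/-- A morphism which equalizes `φ₀` and `φ₁` is the transpose of a morphism `K Z ⟶ X` of `H`. -/
theorem exists_of_condition {Z : E} {X : H} (c : Z ⟶ S.R.obj (S.V.obj X))
    (hc : c ≫ S.φ₀ X = c ≫ S.φ₁ X) : ∃ g : S.K.obj Z ⟶ X, S.tr (S.V.map g) = c := by
  -- The equation required by `lift` is the equalizing condition after transposition.
  obtain ⟨g, hg⟩ := S.lift (S.tr.symm c) (S.K.map c ≫ S.β _) (S.tr.injective (by
    rw [← comp_φ₁, ← hc, φ₀, tr_right, Equiv.apply_symm_apply]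
    rfl))
  exact ⟨g, by rw [hg, Equiv.apply_symm_apply]⟩

theorem comp_tr {Z W : E} {X : H} (m : W ⟶ Z) (g : S.K.obj Z ⟶ X) :
    m ≫ S.tr (S.V.map g) = S.tr (S.V.map (S.K.map m ≫ g)) := by
  rw [Functor.map_comp, tr_left]

/-- If `K` is fully faithful, then an isomorphism `K Z ≅ X` presents `Z` as an equalizer of `φ₀`
and `φ₁`. -/
noncomputable def isLimitOfIso [S.K.Full] [S.K.Faithful] {Z : E} {X : H} (θ : S.K.obj Z ≅ X)
    (c : Z ⟶ S.R.obj (S.V.obj X)) (hc : c = S.tr (S.V.map θ.hom))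
    {p q : S.R.obj (S.V.obj X) ⟶ S.R.obj (S.V.obj (S.G.obj (S.V.obj X)))}
    (hp : p = S.φ₀ X) (hq : q = S.φ₁ X) (h : c ≫ p = c ≫ q) : IsLimit (Fork.ofι c h) := by
  have inj : ∀ {W : E} (m m' : W ⟶ Z), m ≫ c = m' ≫ c → m = m' := by
    intro W m m' e
    rw [hc, comp_tr, comp_tr] at e
    have := S.faithful
    have e' := S.V.map_injective (S.tr.injective e)
    exact S.K.map_injective ((cancel_mono θ.hom).1 e')
  -- A fork on `W` is a morphism `K W ⟶ X`; composing with `θ⁻¹` and using fullness gives the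
  -- factorization through `Z`.
  have ex : ∀ s : Fork p q, ∃ m : s.pt ⟶ Z, m ≫ c = s.ι := by
    intro s
    obtain ⟨g, hg⟩ := S.exists_of_condition s.ι (by rw [← hp, ← hq]; exact s.condition)
    refine ⟨S.K.preimage (g ≫ θ.inv), ?_⟩
    rw [hc, comp_tr, Functor.map_preimage, Category.assoc, Iso.inv_hom_id, Category.comp_id, hg]
  exact Fork.IsLimit.mk _ (fun s => (ex s).choose) (fun s => (ex s).choose_spec)
    (fun s m hm => inj _ _ (hm.trans (ex s).choose_spec.symm))

theorem hasEqualizer_of_isEquivalence [S.K.IsEquivalence] (X : H) :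
    HasEqualizer (S.φ₀ X) (S.φ₁ X) :=
  ⟨⟨⟨_, S.isLimitOfIso (S.K.objObjPreimageIso X) _ rfl rfl rfl (S.condition _)⟩⟩⟩

/-- `K` is an equivalence if `β` is invertible and the unit of `K ⋙ V ⊣ R` has a natural
retraction. -/
theorem isEquivalence_of_retraction [IsIdempotentComplete E] [∀ Q, IsIso (S.β Q)]
    (r : (K S ⋙ V S) ⋙ R S ⟶ 𝟭 E) (hr : S.adjR.unit ≫ r = 𝟙 _) : S.K.IsEquivalence := by
  have := S.faithful
  let r' (Z : E) : S.R.obj (S.V.obj (S.K.obj Z)) ⟶ Z := r.app Z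
  have hr' (Z : E) : S.u Z ≫ r' Z = 𝟙 Z := congrArg (·.app Z) hr
  have r_nat {Z W : E} (m : W ⟶ Z) : S.R.map (S.V.map (S.K.map m)) ≫ r' Z = r' W ≫ m :=
    r.naturality m
  -- the section of the canonical morphism
  let x (X : H) : X ⟶ S.K.obj (S.R.obj (S.V.obj X)) := S.ρ X ≫ inv (S.β (S.V.obj X))
  have hx (X : H) : x X ≫ S.β _ = S.ρ X := by simp [x]
  have hxκ (X : H) : S.V.map (x X) ≫ S.κ _ = 𝟙 _ := by
    rw [← map_β_ε, ← Functor.map_comp_assoc, hx, map_ρ_ε]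
  -- With `hxκ`, this says that `V (x X)` is a coalgebra structure on `V X` for the comonad of `V K
  -- ⊣ R`.
  have coassoc (X : H) : x X ≫ S.K.map (S.R.map (S.V.map (x X))) =
      x X ≫ S.K.map (S.u (S.R.obj (S.V.obj X))) := by
    rw [← cancel_mono (S.β _)]
    apply S.G_ext
    simp only [Functor.map_comp, Category.assoc, map_β_ε, κ_naturality, map_u_κ,
      Category.comp_id, reassoc_of% hxκ X]
  have condx {X : H} {Z : E} (c : Z ⟶ S.R.obj (S.V.obj X)) (hc : c ≫ S.φ₀ X = c ≫ S.φ₁ X) :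
      c ≫ S.R.map (S.V.map (x X)) = c ≫ S.u _ := by
    rw [← cancel_mono (S.R.map (S.V.map (S.β (S.V.obj X))))]
    simp only [Category.assoc, ← Functor.map_comp, hx]
    exact hc
  -- The transpose of `V (K f)` is `f ≫ u`, and `u` is a split monomorphism.
  have hfaithful : S.K.Faithful := ⟨fun {W Z f g} h => by
    have h1 : f ≫ S.u Z = g ≫ S.u Z := by rw [← u_naturality, ← u_naturality, h]
    rw [← Category.comp_id f, ← hr' Z, reassoc_of% h1, hr' Z, Category.comp_id]⟩
  have hxK (Z : E) : x (S.K.obj Z) = S.K.map (S.u Z) := by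
    rw [← cancel_mono (S.β _), hx, S.eq_map_comp_β (S.ρ _), map_ρ_ε, tr_apply, S.R.map_id,
      Category.comp_id]
  have hfull : S.K.Full := ⟨fun {W Z} f => by
    have h := condx _ (S.condition f)
    set c := S.tr (S.V.map f) with hc
    -- The fork formed by `u`, `R V K u` and `u` at `R V K Z` is split by `r`. Since `c` equalizes
    -- the pair, it factors through `u` by `c ≫ r'`.
    have hcu : (c ≫ r' Z) ≫ S.u Z = c := by
      rw [Category.assoc, ← r_nat, ← hxK, reassoc_of% h, hr', Category.comp_id]
    refine ⟨c ≫ r' Z, S.V.map_injective (S.tr.injective ?_)⟩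
    rw [tr_apply, u_naturality, hcu]⟩
  have hess : S.K.EssSurj := ⟨fun X => by
    -- For `X = K Z` this is `r' ≫ u`, the projection onto `Z`. In general its image plays the role
    -- of the missing preimage of `X`.
    let e := S.R.map (S.V.map (x X)) ≫ r' _
    have heu : e ≫ S.u _ = e ≫ S.R.map (S.V.map (x X)) := by
      simp only [e, Category.assoc]
      rw [← r_nat, ← r_nat, ← Functor.map_comp_assoc, ← Functor.map_comp_assoc,
        ← Functor.map_comp, ← Functor.map_comp, coassoc]
    have hee : e ≫ e = e := by
      conv_lhs => rw [show e ≫ e = e ≫ S.R.map (S.V.map (x X)) ≫ r' _ from rfl,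
        ← reassoc_of% heu, hr', Category.comp_id]
    obtain ⟨Z, i, p, hip, hpi⟩ := IsIdempotentComplete.idempotents_split _ e hee
    have hie : i ≫ e = i := by rw [← hpi, reassoc_of% hip]
    have hiu : i ≫ S.R.map (S.V.map (x X)) = i ≫ S.u _ := by
      have h : (i ≫ e) ≫ S.R.map (S.V.map (x X)) = (i ≫ e) ≫ S.u _ := by
        simp only [Category.assoc i, heu]
      rwa [hie] at h
    have hi : i ≫ S.φ₀ X = i ≫ S.φ₁ X := by
      rw [φ₀, φ₁, ← hx, Functor.map_comp, Functor.map_comp, reassoc_of% hiu]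
    obtain ⟨g, hg⟩ := S.exists_of_condition i hi
    have hg' : S.V.map g = S.V.map (S.K.map i) ≫ S.κ _ := by
      rw [← tr_symm_apply, ← hg, Equiv.symm_apply_apply]
    -- The morphism `g` is the transpose of the inclusion `i`. Its inverse is the coalgebra
    -- structure `x X` followed by the projection `K p`.
    refine ⟨Z, ⟨⟨g, x X ≫ S.K.map p, S.V.map_injective ?_, S.V.map_injective ?_⟩⟩⟩
    · simp only [Functor.map_comp, hg', Category.assoc]
      rw [← reassoc_of% S.κ_naturality, ← Functor.map_comp_assoc, ← Functor.map_comp, hiu,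
        Functor.map_comp, Functor.map_comp_assoc, reassoc_of% S.map_u_κ, ← Functor.map_comp,
        ← Functor.map_comp, hip, S.K.map_id, S.V.map_id]
    · have h1 : x X ≫ S.K.map p ≫ S.K.map i = x X ≫ S.K.map (S.u _) ≫ S.K.map (r' _) := by
        rw [← Functor.map_comp, hpi, Functor.map_comp, reassoc_of% coassoc X]
      have h2 : x X ≫ S.K.map p ≫ S.K.map i = x X := by
        rw [h1, ← Functor.map_comp, hr', S.K.map_id, Category.comp_id]
      rw [S.V.map_id, Functor.map_comp, hg', ← Functor.map_comp_assoc, Category.assoc, h2,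
        hxκ]⟩
  exact { }

end ComparisonData

/-! ### Relative Hopf modules as an instance of the formal situation. -/

section

variable {A B : C} [CircMon A] [BullComon A] [IsBimonoid A] [CircMon B]

omit [IsBimonoid A] in
/-- A morphism of relative Hopf modules is invertible if its underlying morphism is. -/
theorem HopfModule.isIso_of_isIso_f {R : ComoduleMonoid A B} {X Y : HopfModule R} (g : X ⟶ Y)
    (h : IsIso g.f) : IsIso g := by
  refine ⟨HopfModule.Hom.mk (inv g.f) ?_ ?_, HopfModule.Hom.ext (IsIso.hom_inv_id g.f),
    HopfModule.Hom.ext (IsIso.inv_hom_id g.f)⟩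
  · rw [IsIso.comp_inv_eq, Category.assoc, g.act_comp, circ_comp_assoc, IsIso.inv_hom_id,
      Category.comp_id, circ_id, Category.id_comp]
  · rw [IsIso.inv_comp_eq, ← Category.assoc, g.comp_coact, Category.assoc, bull_comp,
      IsIso.hom_inv_id, Category.comp_id, bull_id, Category.comp_id]

/-- The functor sending a `B`-module to the cofree relative Hopf module. -/
abbrev cofreeHopfFunctor (R : ComoduleMonoid A B) : RightMod B ⥤ HopfModule R where
  obj Q := cofreeHopf R Q
  map {Q Q'} f := HopfModule.Hom.mk (f.f ●ₘ 𝟙 A)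
    (by
      have h : (f.f ⊚ₘ 𝟙 B) ≫ Q'.a = Q.a ≫ f.f := f.h
      have e : ((f.f ●ₘ 𝟙 A) ⊚ₘ 𝟙 B) ≫ (𝟙 (Q'.A ● A) ⊚ₘ R.coact) =
          (𝟙 (Q.A ● A) ⊚ₘ R.coact) ≫ ((f.f ●ₘ 𝟙 A) ⊚ₘ (𝟙 B ●ₘ 𝟙 A)) := by
        simp only [circ_comp, bull_id, Category.id_comp, Category.comp_id]
      change ((𝟙 (Q.A ● A) ⊚ₘ R.coact) ≫ zeta Q.A A B A ≫ (Q.a ●ₘ mulC A)) ≫ (f.f ●ₘ 𝟙 A) =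
        ((f.f ●ₘ 𝟙 A) ⊚ₘ 𝟙 B) ≫ (𝟙 (Q'.A ● A) ⊚ₘ R.coact) ≫ zeta Q'.A A B A ≫
          (Q'.a ●ₘ mulC A)
      rw [reassoc_of% e, reassoc_of% zeta_natural, bull_comp, h, circ_id, Category.id_comp]
      simp only [Category.assoc, bull_comp, Category.comp_id])
    ((bullComonad A).δ.naturality f.f)
  map_id Q := HopfModule.Hom.ext (bull_id _ _)
  map_comp f g := HopfModule.Hom.ext ((bullRight A).map_comp f.f g.f)

/-- The forgetful functor from relative Hopf modules to `B`-modules is left adjoint to the cofree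
functor. -/
abbrev cofreeHopfAdj (R : ComoduleMonoid A B) :
    HopfModule.forget R ⊣ cofreeHopfFunctor R where
  unit :=
    { app := fun X => X.toCofree
      naturality := fun _ _ f => HopfModule.Hom.ext f.comp_coact }
  counit :=
    { app := fun Q => cofreeCounit R Q
      naturality := fun _ _ f => Monad.Algebra.Hom.ext ((bullComonad A).ε.naturality f.f) }
  left_triangle_components X := Monad.Algebra.Hom.ext X.counit
  right_triangle_components Q := HopfModule.Hom.ext ((bullComonad A).right_counit Q.A)

/-- The categorical data relating `I`-comodules, `B`-modules and relative Hopf modules. -/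
abbrev hopfData (R : ComoduleMonoid A B) :
    ComparisonData (RightComod (unitI C)) (RightMod B) (HopfModule R) where
  K := comparison R
  V := HopfModule.forget R
  R := coind B
  G := cofreeHopfFunctor R
  adjR := indAdj B
  adjG := cofreeHopfAdj R
  faithful := ⟨fun h => HopfModule.Hom.ext (congrArg Monad.Algebra.Hom.f h)⟩
  -- Composing `h` with the counit identifies `t` with the transpose of `k`. By `cofreeHopf_hom_f`,
  -- `k` is then the coaction of `X` followed by `t • A`, so `h` becomes colinearity of `t`.
  lift {X Y} t k h := by
    have hk : (HopfModule.forget R).map k ≫ cofreeCounit R Y.mod = t := by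
      have e : (HopfModule.forget R).map Y.toCofree ≫ cofreeCounit R Y.mod = 𝟙 Y.mod :=
        Monad.Algebra.Hom.ext Y.counit
      have h' := congrArg (fun s => s ≫ cofreeCounit R Y.mod) h
      exact h'.symm.trans ((Category.assoc _ _ _).trans
        ((congrArg (t ≫ ·) e).trans (Category.comp_id _)))
    refine ⟨HopfModule.Hom.mk t.f t.h.symm ?_, rfl⟩
    refine (congrArg Monad.Algebra.Hom.f h).trans ((cofreeHopf_hom_f k).trans ?_)
    rw [hk]
  β Q := betaHopf R Q
  β_counit Q := betaHopf_counit R Q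

omit [IsBimonoid A] in
/-- The canonical map composed with the unit of the free module. -/
theorem unit_beta0 (R : ComoduleMonoid A B) (Q : RightMod B) :
    ((rC (Q.A ● unitI C)).inv ≫ (𝟙 (Q.A ● unitI C) ⊚ₘ oneC B)) ≫
      (𝟙 (Q.A ● unitI C) ⊚ₘ R.coact) ≫ zeta Q.A (unitI C) B A ≫ (Q.a ●ₘ (lC A).hom) =
      𝟙 Q.A ●ₘ oneC A := by
  -- Naturality of the left constraint leaves `lC` at `I`, whereas `right_unit_circ` involves `rC`
  -- there.
  have hl : (lC (unitI C)).hom = (rC (unitI C)).hom :=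
    @MonoidalCategory.unitors_equal C _ DoubleMonoidal.circ
  have e1 : (𝟙 (Q.A ● unitI C) ⊚ₘ oneC B) ≫ (𝟙 (Q.A ● unitI C) ⊚ₘ R.coact) =
      (𝟙 (Q.A ● unitI C) ⊚ₘ comulB (unitI C)) ≫
        ((𝟙 Q.A ●ₘ 𝟙 (unitI C)) ⊚ₘ (oneC B ●ₘ oneC A)) := by
    simp only [circ_comp, bull_id, Category.comp_id, R.one_coact]
  have e2 : ((𝟙 Q.A ⊚ₘ oneC B) ●ₘ (𝟙 (unitI C) ⊚ₘ oneC A)) ≫ (Q.a ●ₘ (lC A).hom) =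
      ((rC Q.A).hom ●ₘ (rC (unitI C)).hom) ≫ (𝟙 Q.A ●ₘ oneC A) := by
    rw [bull_comp, bull_comp, mod_unit, lC_nat, hl, Category.comp_id]
  rw [Category.assoc, Iso.inv_comp_eq, reassoc_of% e1, reassoc_of% zeta_natural,
    e2, reassoc_of% right_unit_circ]

theorem phi0_eq {R : ComoduleMonoid A B} (X : HopfModule R) : phi0 X = (hopfData R).φ₀ X := rfl

/-- The formal `φ₁` applies `β` after the unit of the adjunction. By `unit_beta0`, inserting the
unit of `B` into `β_Q` leaves only `Q • η`, which is the defining formula of `phi1` after `δ`. -/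
theorem phi1_eq {R : ComoduleMonoid A B} (X : HopfModule R) : phi1 X = (hopfData R).φ₁ X := by
  apply Comonad.Coalgebra.Hom.ext
  have h1 := indAdj_unit_f B ((coind B).obj X.mod)
  have h2 := beta0_app_eq R X.mod
  have h : (𝟙 X.mod.A ●ₘ comulB (unitI C)) ≫ (aB _ _ _).inv ≫
        ((𝟙 X.mod.A ●ₘ oneC A) ●ₘ 𝟙 (unitI C)) =
      (((𝟙 X.mod.A ●ₘ comulB (unitI C)) ≫ (aB _ _ _).inv) ≫
        (((rC (X.mod.A ● unitI C)).inv ≫ (𝟙 (X.mod.A ● unitI C) ⊚ₘ oneC B)) ●ₘ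
          𝟙 (unitI C))) ≫ (((𝟙 (X.mod.A ● unitI C) ⊚ₘ R.coact) ≫ zeta X.mod.A (unitI C) B A ≫
            (X.mod.a ●ₘ (lC A).hom)) ●ₘ 𝟙 (unitI C)) := by
    rw [Category.assoc, bull_comp, unit_beta0, Category.comp_id, Category.assoc]
  refine h.trans ?_
  exact congrArg₂ (fun (s : X.mod.A ● unitI C ⟶ ((X.mod.A ● unitI C) ⊚ B) ● unitI C)
    (t : (X.mod.A ● unitI C) ⊚ B ⟶ X.mod.A ● A) => s ≫ (t ●ₘ 𝟙 (unitI C))) h1.symm h2.symm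

/-- The inverse of an underlying morphism is automatically linear and colinear, so invertibility can
be tested in `C`. -/
theorem isIso_beta0_iff (R : ComoduleMonoid A B) :
    IsIso (beta0 R) ↔ ∀ Q, IsIso (betaHopf R Q) := by
  rw [NatTrans.isIso_iff_isIso_app]
  refine forall_congr' fun Q => ⟨fun h => HopfModule.isIso_of_isIso_f _ h, fun h => ?_⟩
  exact inferInstanceAs
    (IsIso ((HopfModule.forget R ⋙ (circMonad B).forget).map (betaHopf R Q)))

theorem isIso_beta0_of_isEquivalence (R : ComoduleMonoid A B)
    [h : (comparison R).IsEquivalence] : IsIso (beta0 R) :=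
  (isIso_beta0_iff R).2 fun Q =>
    @ComparisonData.isIso_β_of_isEquivalence _ _ _ _ _ _ (hopfData R) h Q

theorem hasEqualizer_phi (R : ComoduleMonoid A B) [h : (comparison R).IsEquivalence]
    (X : HopfModule R) : HasEqualizer (phi0 X) (phi1 X) := by
  rw [phi1_eq]
  exact @ComparisonData.hasEqualizer_of_isEquivalence _ _ _ _ _ _ (hopfData R) h X

/-- The hypothesis `hc` is the transpose of `g` written with the explicit unit, so that concrete
maps such as `ι` can be recognized as transposes. -/
theorem eq_tr {R : ComoduleMonoid A B} {Z : RightComod (unitI C)} {X : HopfModule R}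
    (g : (comparison R).obj Z ⟶ X) (c : Z ⟶ (bullComonad (unitI C)).cofree.obj X.mod.A)
    (hc : c.f = Z.a ≫ (((rC Z.A).inv ≫ (𝟙 Z.A ⊚ₘ oneC B) ≫ g.f) ●ₘ 𝟙 (unitI C))) :
    c = (hopfData R).tr ((hopfData R).V.map g) := by
  apply Comonad.Coalgebra.Hom.ext
  have e : ∀ t : Z.A ⊚ B ⟶ X.mod.A,
      Z.a ≫ (((rC Z.A).inv ≫ (𝟙 Z.A ⊚ₘ oneC B) ≫ t) ●ₘ 𝟙 (unitI C)) =
        (Z.a ≫ (((rC Z.A).inv ≫ (𝟙 Z.A ⊚ₘ oneC B)) ●ₘ 𝟙 (unitI C))) ≫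
          (t ●ₘ 𝟙 (unitI C)) := by
    intro t
    rw [Category.assoc, bull_comp, Category.comp_id, Category.assoc]
  rw [ComparisonData.tr_apply]
  exact hc.trans ((e g.f).trans (congrArg
    (fun s : Z.A ⟶ (Z.A ⊚ B) ● unitI C => s ≫ (g.f ●ₘ 𝟙 (unitI C)))
    (indAdj_unit_f B Z).symm))

theorem phi_condition {R : ComoduleMonoid A B} {Z : RightComod (unitI C)} {X : HopfModule R}
    (g : (comparison R).obj Z ⟶ X) (c : Z ⟶ (bullComonad (unitI C)).cofree.obj X.mod.A)
    (hc : c.f = Z.a ≫ (((rC Z.A).inv ≫ (𝟙 Z.A ⊚ₘ oneC B) ≫ g.f) ●ₘ 𝟙 (unitI C))) :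
    c ≫ phi0 X = c ≫ phi1 X := by
  rw [phi1_eq, eq_tr g c hc]
  exact (hopfData R).condition g

/-- For a fully faithful comparison functor, an isomorphism `K Z ≅ X` of relative Hopf modules
presents `Z` as the coinvariant part of `X`. -/
noncomputable def isLimitCoinvariants {R : ComoduleMonoid A B} [h1 : (comparison R).Full]
    [h2 : (comparison R).Faithful] {Z : RightComod (unitI C)} {X : HopfModule R}
    (θ : (comparison R).obj Z ≅ X) (c : Z ⟶ (bullComonad (unitI C)).cofree.obj X.mod.A)
    (hc : c.f = Z.a ≫ (((rC Z.A).inv ≫ (𝟙 Z.A ⊚ₘ oneC B) ≫ θ.hom.f) ●ₘ 𝟙 (unitI C)))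
    (h : c ≫ phi0 X = c ≫ phi1 X) : IsLimit (Fork.ofι c h) :=
  @ComparisonData.isLimitOfIso _ _ _ _ _ _ (hopfData R) h1 h2 Z X θ c (eq_tr θ.hom c hc) _ _
    (phi0_eq X) (phi1_eq X) h

end

/-! ### Relative products over the monoid `I`. -/

section

variable (A : C) [CircMon A]

theorem one_one_mul : (oneC A ⊚ₘ oneC A) ≫ mulC A =
    (lC (unitI C)).hom ≫ oneC A := by
  have h : oneC A ⊚ₘ oneC A = (𝟙 (unitI C) ⊚ₘ oneC A) ≫ (oneC A ⊚ₘ 𝟙 A) := by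
    rw [circ_comp, Category.id_comp, Category.comp_id]
  rw [h, Category.assoc, one_mulC, lC_nat]

theorem isCircMonHom_one : IsCircMonHom (oneC A) :=
  @IsMonHom.mk C _ DoubleMonoidal.circ _ _ _ _ _ (Category.id_comp _) (one_one_mul A).symm

variable {A}

/-- The relative product over the monoid `I` is the product `∘`. -/
theorem relLeft_eq_relRight_unit (P : RightMod (unitI C)) :
    relLeft A P = relRight (oneC A) P := by
  -- The unit axiom leaves only one action of `I` on an object.
  have h : P.a = (rC P.A).hom := by
    have := mod_unit P
    rwa [oneC_unitI, circ_id, Category.id_comp] at this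
  change P.a ⊚ₘ 𝟙 A = (aC P.A (unitI C) A).hom ≫ (𝟙 P.A ⊚ₘ ((oneC A ⊚ₘ 𝟙 A) ≫ mulC A))
  rw [one_mulC, triangleC, h]

end

theorem isIso_coequalizer_desc_iff {D : Type*} [Category* D] {X Y Z : D} {f g : X ⟶ Y}
    [HasCoequalizer f g] (h : f = g) (k : Y ⟶ Z) (w : f ≫ k = g ≫ k) :
    IsIso (coequalizer.desc k w) ↔ IsIso k := by
  have := coequalizer.π_of_eq h
  conv_rhs => rw [← coequalizer.π_desc k w]
  exact (isIso_comp_left_iff _ _).symm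

/-- The identity cofork is a coequalizer of a morphism with itself, and every functor sends it to
another identity cofork. -/
theorem preservesColimit_parallelPair_self {D E : Type*} [Category* D] [Category* E] {X Y : D}
    (f : X ⟶ Y) (F : D ⥤ E) : PreservesColimit (parallelPair f f) F :=
  preservesColimit_of_preserves_colimit_cocone (isColimitIdCofork rfl)
    ((isColimitMapCoconeCoforkEquiv F _).symm
      (IsColimit.ofIsoColimit (isColimitIdCofork (f := F.map f) rfl)
        (Cofork.ext (Iso.refl _) (by simp [idCofork]))))

/-! ### The extension `η : I ⟶ A` and the three implications. -/

section

variable {A : C} [CircMon A] [BullComon A] [IsBimonoid A]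

/-- The canonical map factors through the relative product over `I` by an isomorphism. -/
theorem isIso_beta_iff {S : ComoduleMonoid (unitI C) (unitI C)}
    (P : CoinvariantPart (ComoduleMonoid.regular A) S) (hω : IsCircMonHom (oneC A))
    (h : oneC A = P.omega)
    (hc : ∀ M : RightMod (unitI C), HasCoequalizer (relLeft A M) (relRight (oneC A) M))
    (Q : RightMod A) :
    IsIso (beta P hω h hc Q) ↔ IsIso ((beta0 (ComoduleMonoid.regular A)).app Q) := by
  have := hc (bullMod S (restrictMod (oneC A) hω Q))
  exact isIso_coequalizer_desc_iff (relLeft_eq_relRight_unit _) _ _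

theorem unit_colinear (A : C) [CircMon A] :
    (comulB (unitI C) ≫ (oneC A ●ₘ 𝟙 (unitI C))) ≫ (𝟙 A ●ₘ comulB (unitI C)) ≫
        (aB A (unitI C) (unitI C)).inv =
      comulB (unitI C) ≫ ((comulB (unitI C) ≫ (oneC A ●ₘ 𝟙 (unitI C))) ●ₘ 𝟙 (unitI C)) := by
  have e1 : (oneC A ●ₘ 𝟙 (unitI C)) ≫ (𝟙 A ●ₘ comulB (unitI C)) =
      (𝟙 (unitI C) ●ₘ comulB (unitI C)) ≫ (oneC A ●ₘ (𝟙 (unitI C) ●ₘ 𝟙 (unitI C))) := by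
    simp only [bull_comp, bull_id, Category.id_comp, Category.comp_id]
  rw [Category.assoc, reassoc_of% e1, aB_inv_nat, reassoc_of% comul_assocB,
    Iso.hom_inv_id_assoc, bull_comp, Category.comp_id]

/-- The unit constraint `I ∘ A ⟶ A` as a morphism of Hopf modules. -/
abbrev comparisonUnitHom (A : C) [CircMon A] [BullComon A] [IsBimonoid A] :
    (comparison (ComoduleMonoid.regular A)).obj (ComoduleMonoid.regular (unitI C)).comod ⟶
      (ComoduleMonoid.regular A).hopf :=
  HopfModule.Hom.mk (lC A).hom ((Category.assoc _ _ _).trans (lC_mul A).symm) (by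
    change (lC A).hom ≫ comulB A = ((comulB (unitI C) ⊚ₘ comulB A) ≫
      zeta (unitI C) (unitI C) A A ≫ (𝟙 (unitI C ⊚ A) ●ₘ (lC A).hom)) ≫ ((lC A).hom ●ₘ 𝟙 A)
    simp only [lC_comul, Category.assoc, bull_comp, Category.id_comp, Category.comp_id])

/-- The unit constraint `I ∘ A ≅ A` as an isomorphism of Hopf modules. -/
noncomputable def comparisonUnitIso (A : C) [CircMon A] [BullComon A] [IsBimonoid A] :
    (comparison (ComoduleMonoid.regular A)).obj (ComoduleMonoid.regular (unitI C)).comod ≅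
      (ComoduleMonoid.regular A).hopf :=
  haveI := HopfModule.isIso_of_isIso_f (comparisonUnitHom A) (inferInstanceAs (IsIso (lC A).hom))
  asIso (comparisonUnitHom A)

/-- Exhibits the candidate `ι` as the transpose of the isomorphism `I ∘ A ≅ A`, which is what makes
it an equalizer. -/
theorem unit_eq (A : C) [CircMon A] : comulB (unitI C) ≫ (oneC A ●ₘ 𝟙 (unitI C)) =
    comulB (unitI C) ≫ (((rC (unitI C)).inv ≫ (𝟙 (unitI C) ⊚ₘ oneC A) ≫ (lC A).hom) ●ₘ
      𝟙 (unitI C)) := by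
  have hl : (lC (unitI C)).hom = (rC (unitI C)).hom :=
    @MonoidalCategory.unitors_equal C _ DoubleMonoidal.circ
  rw [lC_nat, hl, Iso.inv_hom_id_assoc]

/-- The coinvariant part of `A` is `I`, if the comparison functor is fully faithful. -/
noncomputable def unitCoinvariantPart (A : C) [CircMon A] [BullComon A] [IsBimonoid A]
    [(comparison (ComoduleMonoid.regular A)).Full]
    [(comparison (ComoduleMonoid.regular A)).Faithful] :
    CoinvariantPart (ComoduleMonoid.regular A) (ComoduleMonoid.regular (unitI C)) where
  ι := comulB (unitI C) ≫ (oneC A ●ₘ 𝟙 (unitI C))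
  colinear := unit_colinear A
  condition := phi_condition (comparisonUnitIso A).hom _ (unit_eq A)
  isLimit := isLimitCoinvariants (comparisonUnitIso A) _ (unit_eq A) _
  one_ι := Category.id_comp _
  mul_ι := by
    have e1 : ((lC (unitI C)).hom ●ₘ (lC (unitI C)).hom) ≫ (oneC A ●ₘ 𝟙 (unitI C)) =
        ((oneC A ⊚ₘ oneC A) ●ₘ (𝟙 (unitI C) ⊚ₘ 𝟙 (unitI C))) ≫
          (mulC A ●ₘ (lC (unitI C)).hom) := by
      rw [bull_comp, bull_comp, one_one_mul, circ_id, Category.id_comp, Category.comp_id]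
    rw [mulC_unitI, ← Category.assoc, lC_comul, Category.assoc, Category.assoc, e1,
      ← reassoc_of% zeta_natural, circ_comp_assoc]

theorem isGaloisExtension_unit (A : C) [CircMon A] [BullComon A] [IsBimonoid A]
    [(comparison (ComoduleMonoid.regular A)).IsEquivalence] :
    IsGaloisExtension (ComoduleMonoid.regular A) (oneC A) := by
  have hc (M : RightMod (unitI C)) : HasCoequalizer (relLeft A M) (relRight (oneC A) M) := by
    rw [← relLeft_eq_relRight_unit]
    infer_instance
  refine ⟨isCircMonHom_one A, hasEqualizer_phi _, ComoduleMonoid.regular (unitI C),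
    unitCoinvariantPart A, ?_, hc, fun M n => ?_, fun Q => ?_⟩
  -- The map `ω` attached to `ι` reduces to `η` by the counit axiom of `I`.
  · change _ = (comulB (unitI C) ≫ (oneC A ●ₘ 𝟙 (unitI C))) ≫ (𝟙 A ●ₘ tau C) ≫ (rB A).hom
    have e : (oneC A ●ₘ 𝟙 (unitI C)) ≫ (𝟙 A ●ₘ tau C) =
        (𝟙 (unitI C) ●ₘ tau C) ≫ (oneC A ●ₘ 𝟙 (unitJ C)) := by
      simp only [bull_comp, Category.id_comp, Category.comp_id]
    rw [Category.assoc, reassoc_of% e, rB_nat, ← Category.assoc (_ ●ₘ _), ← Category.assoc,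
      comul_counitB, Category.id_comp]
  · rw [← relLeft_eq_relRight_unit]
    exact preservesColimit_parallelPair_self _ _
  · rw [isIso_beta_iff]
    exact (NatTrans.isIso_iff_isIso_app _).1 (isIso_beta0_of_isEquivalence _) Q

/-- The natural transformation induced by the counit `A ⟶ J`. -/
abbrev indCoindCounit (A : C) [CircMon A] [BullComon A] :
    ind A ⋙ coind A ⟶ ind (unitJ C) ⋙ coind (unitJ C) where
  app Z := (bullComonad (unitI C)).cofree.map (𝟙 Z.A ⊚ₘ counitB A)
  naturality Z W f := by
    refine ((bullComonad (unitI C)).cofree.map_comp _ _).symm.trans (.trans ?_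
      ((bullComonad (unitI C)).cofree.map_comp _ _))
    refine congrArg (bullComonad (unitI C)).cofree.map ?_
    change (f.f ⊚ₘ 𝟙 A) ≫ (𝟙 W.A ⊚ₘ counitB A) = (𝟙 Z.A ⊚ₘ counitB A) ≫ (f.f ⊚ₘ 𝟙 (unitJ C))
    simp only [circ_comp, Category.id_comp, Category.comp_id]

/-- This is the bimonoid axiom `ε η = τ`, since `τ` is also the unit of the monoid `J`. -/
theorem unit_indCoindCounit (A : C) [CircMon A] [BullComon A] [IsBimonoid A] :
    (indAdj A).unit ≫ indCoindCounit A = (indAdj (unitJ C)).unit := by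
  ext Z : 2
  apply Comonad.Coalgebra.Hom.ext
  rw [indAdj_unit_f]
  refine (congrArg (fun s : Z.A ⟶ (Z.A ⊚ A) ● unitI C =>
    s ≫ ((𝟙 Z.A ⊚ₘ counitB A) ●ₘ 𝟙 (unitI C))) (indAdj_unit_f A Z)).trans ?_
  dsimp only
  rw [Category.assoc, bull_comp, Category.assoc, circ_comp, IsBimonoid.one_counit,
    one_eq_counit, Category.comp_id, Category.comp_id]

theorem isEquivalence_of_isIso_beta0 [IsIdempotentComplete C] [(functorH C).Full]
    [(functorH C).Faithful] (A : C) [CircMon A] [BullComon A] [IsBimonoid A]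
    (h : IsIso (beta0 (ComoduleMonoid.regular A))) :
    (comparison (ComoduleMonoid.regular A)).IsEquivalence := by
  have := coalgebra_isIdempotentComplete (bullComonad (unitI C))
  have hβ := (isIso_beta0_iff _).1 h
  -- The left adjoint `ind J` is `H`, and a fully faithful left adjoint has invertible unit.
  have hu : IsIso (indAdj (unitJ C)).unit :=
    @Adjunction.unit_isIso_of_L_fully_faithful _ _ _ _ _ _ (indAdj (unitJ C))
      (inferInstanceAs (functorH C).Full) (inferInstanceAs (functorH C).Faithful)
  refine @ComparisonData.isEquivalence_of_retraction _ _ _ _ _ _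
    (hopfData (ComoduleMonoid.regular A)) this hβ
    -- The retraction applies `ε` and then inverts the unit for `J`; it is natural in the comodule
    -- as a composite of natural transformations.
    (indCoindCounit A ≫ inv (indAdj (unitJ C)).unit) ?_
  refine (Category.assoc _ _ _).symm.trans ?_
  exact (congrArg (· ≫ inv (indAdj (unitJ C)).unit) (unit_indCoindCounit A)).trans
    (IsIso.hom_inv_id _)

end

end DuoidalCategory

theorem theorem3p11 {C : Type u} [Category.{v} C] [DuoidalCategory C]
    [IsIdempotentComplete C]
    [(DuoidalCategory.functorH C).Full] [(DuoidalCategory.functorH C).Faithful]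
    (A : C) [CircMon A] [BullComon A] [DuoidalCategory.IsBimonoid A] :
    List.TFAE
      [DuoidalCategory.IsGaloisExtension (DuoidalCategory.ComoduleMonoid.regular A) (oneC A),
        IsIso (DuoidalCategory.beta0 (DuoidalCategory.ComoduleMonoid.regular A)),
        (DuoidalCategory.comparison
          (DuoidalCategory.ComoduleMonoid.regular A)).IsEquivalence] := by
  tfae_have 1 → 2 := by
    rintro ⟨hω, -, S, P, h, hc, -, hβ⟩
    rw [NatTrans.isIso_iff_isIso_app]
    exact fun Q => (DuoidalCategory.isIso_beta_iff P hω h hc Q).1 (hβ Q)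
  tfae_have 2 → 3 := DuoidalCategory.isEquivalence_of_isIso_beta0 A
  tfae_have 3 → 1 := fun h => DuoidalCategory.isGaloisExtension_unit A
  tfae_finish
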